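/- Setting. For every $n\ge 1$ let $\mathbf R_n$ be a $p_n\times p_n$ Hermitian positive definite matrix with smallest eigenvalue $1$ and spectral norm $\|\mathbf R_n\|=M$, with $M$ finite and independent of $n$, where $p_n/n\to\gamma\in(0,1)\cup(1,\infty)$. Let $\mathbf s_n$ be uniformly distributed on the unit sphere of $\mathbb C^{p_n}$, and let $\mathbf X_n$ be a random $p_n\times n$ matrix, independent of $\mathbf s_n$, whose columns are i.i.d. $\mathcal{CN}(\mathbf 0,\mathbf R_n)$ (circularly symmetric complex Gaussian). Let $a\in\mathbb C\setminus\{0\}$ be fixed. The hypothesis $\mathcal H_1^n$ states that, given $(\mathbf s_n,\mathbf X_n)$, the test vector $\mathbf x$ is distributed as $\mathcal{CN}(a\mathbf s_n,\mathbf R_n)$. A prime denotes the conjugate transpose. Let $\mathbf S_n=n^{-1}\mathbf X_n\mathbf X_n'$. A measurable function $\hat{\mathbf R}_n=\hat{\mathbf R}_n(\mathbf X_n)$ of the training data with values in the Hermitian positive definite $p_n\times p_n$ matrices is a *shrinkage estimator* if (i) $\hat{\mathbf R}_n=\mathbf U_n\mathbf D_n\mathbf U_n'$ with a random unitary matrix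 $\mathbf U_n$ such that $\mathbf U_n'\mathbf S_n\mathbf U_n$ is diagonal and a random positive definite diagonal matrix $\mathbf D_n$, and (ii) $\limsup_n\|\hat{\mathbf R}_n\|$ and $\sup_n\|\hat{\mathbf R}_n^{-1}\|$ are almost surely bounded by constants. A *shrinkage oracle* is a matrix $\mathbf R_n^*=\mathbf U_n\,\mathrm{diag}(\mathbf u_{n,1}'\mathbf R_n\mathbf u_{n,1},\dots,\mathbf u_{n,p_n}'\mathbf R_n\mathbf u_{n,p_n})\,\mathbf U_n'$, where $\mathbf U_n=[\mathbf u_{n,1},\dots,\mathbf u_{n,p_n}]$ is a random unitary matrix such that $\mathbf U_n'\mathbf S_n\mathbf U_n$ is diagonal. The estimator $\hat{\mathbf R}_n$ is *oracle consistent* if it is a shrinkage estimator and $p_n^{-1}\|\hat{\mathbf R}_n-\mathbf R_n^*\|_{\mathrm F}^2\to0$ in probability for a sequence of shrinkage oracles $\mathbf R_n^*$. Put $$T_n=\frac{|\mathbf s_n'\hat{\mathbf R}_n^{-1}\mathbf x|^2}{\mathbf s_n'\hat{\mathbf R}_n^{-1}\mathbf s_n},\qquad \hat\nu_n(\mathbf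 x)=\frac{|\mathbf s_n'\hat{\mathbf R}_n^{-1}\mathbf x|}{(\mathbf s_n'\hat{\mathbf R}_n^{-1}\mathbf s_n)^{1/2}},\qquad p_{\mathrm d}^n(\tau)=\Pr[T_n>\tau\mid\mathcal H_1^n,\mathbf s_n,\mathbf X_n],$$ $$Q(\alpha,\beta)=\int_\alpha^\infty e^{-z-\beta}I_0(2\sqrt{\beta z})\,dz,$$ where $I_0$ is the modified Bessel function of the first kind of order $0$. Theorem 4. Suppose $\hat{\mathbf R}_n$ is oracle consistent. Let $q\in[0,1)$, let $\tau\ge0$, and let $$\hat\nu_{n\pm}(\mathbf x,q)=\max\Big\{0,\ \hat\nu_n(\mathbf x)\pm\sqrt{\log\tfrac1{1-q}}\Big\}.$$ Then the conditional probability $$\pi_n=\Pr\big[\,Q(\tau,\hat\nu_{n-}(\mathbf x,q)^2)\le p_{\mathrm d}^n(\tau)\le Q(\tau,\hat\nu_{n+}(\mathbf x,q)^2)\ \big|\ \mathcal H_1^n,\mathbf s_n,\mathbf X_n\big]$$ is asymptotically greater than or equal to $q$, that is, $\max\{q-\pi_n,0\}\to0$ in probability as $n\to\infty$. -/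

import Mathlib

open MeasureTheory ProbabilityTheory Filter Topology
open scoped Matrix ComplexOrder ENNReal NNReal

/-- Complex (or real) matrices carry the product (entrywise) σ-algebra. -/
instance instMeasurableSpaceMatrix {ι κ α : Type*} [MeasurableSpace α] :
    MeasurableSpace (Matrix ι κ α) :=
  inferInstanceAs (MeasurableSpace (ι → κ → α))

noncomputable section

namespace AMF

/-! ### Probability distributions -/

/-- The standard circularly symmetric complex Gaussian distribution `CN(0, 1)` on `ℂ`: independent
real and imaginary parts, each `N(0, 1/2)`. -/
def stdComplexGaussian : Measure ℂ :=
  ((gaussianReal 0 (1 / 2)).prod (gaussianReal 0 (1 / 2))).map fun z => (⟨z.1, z.2⟩ : ℂ)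

/-- The circularly symmetric complex Gaussian distribution `CN(m, R)` with mean `m` and positive
semidefinite covariance matrix `R`: the law of `m + R^{1/2} z`, where `z` has i.i.d. `CN(0, 1)`
entries and `R^{1/2}` is the positive semidefinite square root. -/
def complexGaussian {k : ℕ} (m : Fin k → ℂ) (R : Matrix (Fin k) (Fin k) ℂ) :
    Measure (Fin k → ℂ) :=
  (Measure.pi fun _ : Fin k => stdComplexGaussian).map fun z => m + cfc Real.sqrt R *ᵥ z

/-- The uniform distribution on the Euclidean unit sphere of `ℂ^k`, i.e. normalized surface
measure, regarded as a measure on `ℂ^k`. -/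
def sphereUniform (k : ℕ) : Measure (Fin k → ℂ) :=
  (((volume : Measure (EuclideanSpace ℂ (Fin k))).toSphere Set.univ)⁻¹ •
    (volume : Measure (EuclideanSpace ℂ (Fin k))).toSphere).map fun v => WithLp.ofLp v.1

/-! ### Asymptotics of random variables -/

/-- `Y_n` is asymptotically less than or equal to `Z_n`: `max {Y_n - Z_n, 0} → 0` in
probability. -/
def AsympLE {Ω : Type*} [MeasurableSpace Ω] (μ : Measure Ω) (Y Z : ℕ → Ω → ℝ) : Prop :=
  TendstoInMeasure μ (fun n ω => max (Y n ω - Z n ω) 0) atTop fun _ => 0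

/-! ### Covariance estimators -/

/-- Spectral (Euclidean operator) norm of a square complex matrix. -/
def specNorm {k : ℕ} (A : Matrix (Fin k) (Fin k) ℂ) : ℝ :=
  ‖Matrix.toEuclideanCLM (n := Fin k) (𝕜 := ℂ) A‖

/-- The sample covariance matrix `n⁻¹ X X'`. -/
def sampleCov {k n : ℕ} (X : Matrix (Fin k) (Fin n) ℂ) : Matrix (Fin k) (Fin k) ℂ :=
  (n : ℂ)⁻¹ • (X * Xᴴ)

/-- `U` is a unitary matrix whose columns are eigenvectors of the sample covariance of `X`. -/
def IsSampleEigenbasis {k n : ℕ} (X : Matrix (Fin k) (Fin n) ℂ)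
    (U : Matrix (Fin k) (Fin k) ℂ) : Prop :=
  U ∈ Matrix.unitaryGroup (Fin k) ℂ ∧ (Uᴴ * sampleCov X * U).IsDiag

/-- The matrix `U diag(u_1' R u_1, …, u_k' R u_k) U'`, where `u_i` is the `i`-th column of `U`. -/
def oracleMatrix {k : ℕ} (R U : Matrix (Fin k) (Fin k) ℂ) : Matrix (Fin k) (Fin k) ℂ :=
  U * Matrix.diagonal (fun i => star (U.col i) ⬝ᵥ (R *ᵥ U.col i)) * Uᴴ

/-- The normalized squared Frobenius loss `k⁻¹ ‖A - B‖_F²`. -/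
def frobLoss {k : ℕ} (A B : Matrix (Fin k) (Fin k) ℂ) : ℝ :=
  (k : ℝ)⁻¹ * ∑ i, ∑ j, ‖A i j - B i j‖ ^ 2

/-- Shrinkage estimators. For every sample size `n ≥ 1`, `Rhat n` is a measurable function of the
`p n × n` data matrix with Hermitian positive definite values. -/
structure IsShrinkageEstimator {Ω : Type*} [MeasurableSpace Ω] (μ : Measure Ω) {p : ℕ → ℕ}
    (X : ∀ n, Ω → Matrix (Fin (p n)) (Fin n) ℂ)
    (Rhat : ∀ n, Matrix (Fin (p n)) (Fin n) ℂ → Matrix (Fin (p n)) (Fin (p n)) ℂ) : Prop where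
  measurable : ∀ n, 1 ≤ n → Measurable (Rhat n)
  posDef : ∀ n, 1 ≤ n → ∀ Y, (Rhat n Y).PosDef
  /-- `Rhat = U D U'` with a random sample eigenbasis `U` and a random positive definite diagonal
  matrix `D`. -/
  spectral : ∀ n, 1 ≤ n → ∃ (U : Ω → Matrix (Fin (p n)) (Fin (p n)) ℂ) (d : Ω → Fin (p n) → ℝ),
    Measurable U ∧ Measurable d ∧ ∀ᵐ ω ∂μ, IsSampleEigenbasis (X n ω) (U ω) ∧
      (∀ i, 0 < d ω i) ∧
      Rhat n (X n ω) = U ω * Matrix.diagonal (fun i => (d ω i : ℂ)) * (U ω)ᴴ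
  /-- `limsup_n ‖Rhat‖` is almost surely bounded by a constant. -/
  limsup_bounded : ∃ C : ℝ≥0, ∀ᵐ ω ∂μ,
    limsup (fun n => ENNReal.ofReal (specNorm (Rhat n (X n ω)))) atTop ≤ C
  /-- `sup_n ‖Rhat⁻¹‖` is almost surely bounded by a constant. -/
  inv_bounded : ∃ C : ℝ, ∀ᵐ ω ∂μ, ∀ n, 1 ≤ n → specNorm (Rhat n (X n ω))⁻¹ ≤ C

/-- A sequence of shrinkage oracles: `Rstar n = U diag(u_i' R u_i) U'` for a random sample
eigenbasis `U = [u_1, …]`. -/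
def IsShrinkageOracle {Ω : Type*} [MeasurableSpace Ω] (μ : Measure Ω) {p : ℕ → ℕ}
    (R : ∀ n, Matrix (Fin (p n)) (Fin (p n)) ℂ)
    (X : ∀ n, Ω → Matrix (Fin (p n)) (Fin n) ℂ)
    (Rstar : ∀ n, Ω → Matrix (Fin (p n)) (Fin (p n)) ℂ) : Prop :=
  ∀ n, 1 ≤ n → ∃ U : Ω → Matrix (Fin (p n)) (Fin (p n)) ℂ, Measurable U ∧
    ∀ᵐ ω ∂μ, IsSampleEigenbasis (X n ω) (U ω) ∧ Rstar n ω = oracleMatrix (R n) (U ω)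

/-- Oracle consistency: `Rhat` is a shrinkage estimator whose normalized squared Frobenius distance
to some sequence of shrinkage oracles tends to `0` in probability. -/
def IsOracleConsistent {Ω : Type*} [MeasurableSpace Ω] (μ : Measure Ω) {p : ℕ → ℕ}
    (R : ∀ n, Matrix (Fin (p n)) (Fin (p n)) ℂ)
    (X : ∀ n, Ω → Matrix (Fin (p n)) (Fin n) ℂ)
    (Rhat : ∀ n, Matrix (Fin (p n)) (Fin n) ℂ → Matrix (Fin (p n)) (Fin (p n)) ℂ) : Prop :=
  IsShrinkageEstimator μ X Rhat ∧
    ∃ Rstar : ∀ n, Ω → Matrix (Fin (p n)) (Fin (p n)) ℂ, IsShrinkageOracle μ R X Rstar ∧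
      TendstoInMeasure μ (fun n ω => frobLoss (Rhat n (X n ω)) (Rstar n ω)) atTop fun _ => 0

/-! ### The detector, its conditional detection rate, and the confidence limits -/

/-- The adaptive matched filter statistic `|s' P⁻¹ x|² / (s' P⁻¹ s)`; for positive definite `P` the
denominator is a nonnegative real number. -/
def amfStat {k : ℕ} (s : Fin k → ℂ) (P : Matrix (Fin k) (Fin k) ℂ) (x : Fin k → ℂ) : ℝ :=
  ‖star s ⬝ᵥ (P⁻¹ *ᵥ x)‖ ^ 2 / (star s ⬝ᵥ (P⁻¹ *ᵥ s)).re

/-- `ν̂(s, P, x) = |s' P⁻¹ x| / (s' P⁻¹ s)^{1/2}`. -/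
def nuHat {k : ℕ} (s : Fin k → ℂ) (P : Matrix (Fin k) (Fin k) ℂ) (x : Fin k → ℂ) : ℝ :=
  ‖star s ⬝ᵥ (P⁻¹ *ᵥ x)‖ / Real.sqrt (star s ⬝ᵥ (P⁻¹ *ᵥ s)).re

/-- `max {0, ν̂ - (log (1 / (1 - q)))^{1/2}}`. -/
def nuMinus {k : ℕ} (q : ℝ) (s : Fin k → ℂ) (P : Matrix (Fin k) (Fin k) ℂ) (x : Fin k → ℂ) : ℝ :=
  max 0 (nuHat s P x - Real.sqrt (Real.log (1 / (1 - q))))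

/-- `max {0, ν̂ + (log (1 / (1 - q)))^{1/2}}`. -/
def nuPlus {k : ℕ} (q : ℝ) (s : Fin k → ℂ) (P : Matrix (Fin k) (Fin k) ℂ) (x : Fin k → ℂ) : ℝ :=
  max 0 (nuHat s P x + Real.sqrt (Real.log (1 / (1 - q))))

/-- The modified Bessel function of the first kind of order `0`. -/
def besselI0 (x : ℝ) : ℝ := ∑' k : ℕ, (x / 2) ^ (2 * k) / (k.factorial : ℝ) ^ 2

/-- `Q(α, β) = ∫_α^∞ exp (-z - β) I₀(2 √(β z)) dz`, for `α, β ≥ 0`. -/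
def marcumQ (α β : ℝ) : ℝ :=
  ∫ z in Set.Ioi α, Real.exp (-z - β) * besselI0 (2 * Real.sqrt (β * z))

/-- The σ-algebra generated by the steering vector and the training data. -/
abbrev dataSigma {Ω : Type*} {k n : ℕ} (s : Ω → Fin k → ℂ) (X : Ω → Matrix (Fin k) (Fin n) ℂ) :
    MeasurableSpace Ω :=
  MeasurableSpace.comap (fun ω => (s ω, X ω)) inferInstance

/-- The conditional detection rate `Pr[T > τ | s, X]` of the detector formed from the estimator
`Rhat`; `x` is the test datum, distributed according to the hypothesis in force. -/
def detRate {Ω : Type*} [MeasurableSpace Ω] (μ : Measure Ω) {k n : ℕ}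
    (s : Ω → Fin k → ℂ) (X : Ω → Matrix (Fin k) (Fin n) ℂ) (x : Ω → Fin k → ℂ)
    (Rhat : Matrix (Fin k) (Fin n) ℂ → Matrix (Fin k) (Fin k) ℂ) (τ : ℝ) : Ω → ℝ :=
  μ⟦{ω | τ < amfStat (s ω) (Rhat (X ω)) (x ω)} | dataSigma s X⟧

end AMF

end

namespace AMF

/-! ### The standard complex Gaussian distribution -/

/-! Fix the data and write `P` for the estimator, `D = s' P⁻¹ s` and `N = s' P⁻¹ R P⁻¹ s`. The noise
`x - a s` is `CN(0, R)` and independent of the data, so the filter output is `a D + √N g` with `g ∼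
CN(0, 1)`. After a phase rotation, `ν̂` is distributed as `|ν + σ g|` with `ν = |a| √D` and `σ = √(N
/ D)`, and the detection rate is the probability that this modulus exceeds `√τ`
(`complexGaussian_lt_amfStat`).

If `σ = 1`, the detection rate is exactly `Q(τ, ν²)` (`marcumQ_sq`). Moreover `|ν̂ - ν| ≤ |g|`, and
`|g| ≤ r := √log(1/(1-q))` has probability `1 - exp(-r²) = q`. On that event `ν` lies between the
two confidence limits, and `Q(τ, ν²)` is monotone in `ν ≥ 0`, so coverage is at least `q`.

It remains to see that `σ` is close to `1`. For an inverse oracle `B` the traces of `B R B` and `B`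
coincide, because the oracle eigenvalues are the diagonal entries of `U' R U`. Frobenius closeness
carries this over to `P⁻¹` (`exists_trace_approx`), and concentration of quadratic forms on the
sphere replaces normalized traces by `D` and `N` (`integral_quadForm_sub_trace_sq_le`). Hence `N -
D` is small and `D` is bounded away from `0` and `∞` with probability tending to one
(`tendsto_measure_compl_goodSet`).

The error in `σ` is absorbed by a margin `δ`. By strict monotonicity of `Q` and compactness, for `σ`
near `1` the detection rate lies between `Q(τ, (ν - δ)²)` and `Q(τ, (ν + δ)²)`, uniformly in `ν`
(`eventually_tail_mem_Icc`). So `|ν̂ - ν| ≤ r - δ` suffices for coverage, and this event has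
conditional probability close to `q` (`exists_margin`, `le_condProb_confidence`). -/

theorem measurable_mk_complex : Measurable fun z : ℝ × ℝ => (⟨z.1, z.2⟩ : ℂ) :=
  Complex.measurableEquivRealProd.symm.measurable

instance : IsProbabilityMeasure stdComplexGaussian :=
  Measure.isProbabilityMeasure_map measurable_mk_complex.aemeasurable

theorem stdComplexGaussian_eq_withDensity :
    stdComplexGaussian =
      volume.withDensity fun z : ℂ => ENNReal.ofReal (Real.pi⁻¹ * Real.exp (-‖z‖ ^ 2)) := by
  have h2 : (1 / 2 : ℝ≥0) ≠ 0 := by norm_num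
  have hmap : ∀ f : ℂ → ℝ≥0∞, Measurable f →
      (volume.withDensity fun z : ℝ × ℝ => f ⟨z.1, z.2⟩).map (fun z : ℝ × ℝ => (⟨z.1, z.2⟩ : ℂ)) =
        volume.withDensity f := by
    intro f hf
    ext s hs
    rw [Measure.map_apply measurable_mk_complex hs,
      withDensity_apply _ (measurable_mk_complex hs), withDensity_apply _ hs]
    exact Complex.volume_preserving_equiv_real_prod.symm.setLIntegral_comp_preimage hs hf
  rw [← hmap _ (by fun_prop), stdComplexGaussian, gaussianReal_of_var_ne_zero _ h2,
    prod_withDensity (measurable_gaussianPDF _ _) (measurable_gaussianPDF _ _)]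
  congr 2
  ext z
  rw [gaussianPDF, gaussianPDF, ← ENNReal.ofReal_mul (gaussianPDFReal_nonneg _ _ _)]
  congr 1
  simp only [gaussianPDFReal, sub_zero]
  rw [mul_mul_mul_comm, ← Real.exp_add, ← mul_inv, ← Complex.normSq_eq_norm_sq, Complex.normSq_mk]
  have : (2 * Real.pi * ((1 / 2 : ℝ≥0) : ℝ)) = Real.pi := by push_cast; ring
  rw [this, Real.mul_self_sqrt Real.pi_pos.le]
  congr 2
  push_cast
  ring

theorem charFun_stdComplexGaussian (t : ℂ) :
    charFun stdComplexGaussian t = Complex.exp (-(‖t‖ ^ 2 / 4 : ℝ)) := by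
  rw [charFun_apply, stdComplexGaussian, integral_map measurable_mk_complex.aemeasurable
    (by fun_prop)]
  have h : ∀ z : ℝ × ℝ, Complex.exp ((inner ℝ (⟨z.1, z.2⟩ : ℂ) t : ℝ) * Complex.I) =
      Complex.exp (t.re * z.1 * Complex.I) * Complex.exp (t.im * z.2 * Complex.I) := by
    intro z
    rw [← Complex.exp_add, Complex.inner]
    congr 1
    simp
    ring
  simp_rw [h]
  rw [integral_prod_mul (fun x : ℝ => Complex.exp (t.re * x * Complex.I))
    (fun y : ℝ => Complex.exp (t.im * y * Complex.I)), ← charFun_apply_real, ← charFun_apply_real,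
    charFun_gaussianReal, charFun_gaussianReal, ← Complex.exp_add, ← Complex.normSq_eq_norm_sq,
    Complex.normSq_apply]
  congr 1
  push_cast
  ring

/-- A linear functional of a vector with i.i.d. standard complex Gaussian entries. -/
theorem map_dotProduct_stdComplexGaussian {k : ℕ} (v : Fin k → ℂ) :
    (Measure.pi fun _ : Fin k => stdComplexGaussian).map (fun z => v ⬝ᵥ z) =
      stdComplexGaussian.map fun g => ((√(∑ i, ‖v i‖ ^ 2) : ℝ) : ℂ) * g := by
  have hm : Measurable fun z : Fin k → ℂ => v ⬝ᵥ z := by unfold dotProduct; fun_prop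
  have : IsProbabilityMeasure
      ((Measure.pi fun _ : Fin k => stdComplexGaussian).map (fun z => v ⬝ᵥ z)) :=
    Measure.isProbabilityMeasure_map hm.aemeasurable
  have : IsProbabilityMeasure
      (stdComplexGaussian.map fun g => ((√(∑ i, ‖v i‖ ^ 2) : ℝ) : ℂ) * g) :=
    Measure.isProbabilityMeasure_map (by fun_prop)
  have hin : ∀ c g t : ℂ, inner ℝ (c * g) t = inner ℝ g (star c * t) := by
    intro c g t
    simp [Complex.inner]
    ring
  apply Measure.ext_of_charFun
  ext t
  rw [charFun_apply, charFun_apply, integral_map hm.aemeasurable (by fun_prop),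
    integral_map (by fun_prop) (by fun_prop)]
  have h1 : ∀ z : Fin k → ℂ, Complex.exp ((inner ℝ (v ⬝ᵥ z) t : ℝ) * Complex.I) =
      ∏ i, Complex.exp ((inner ℝ (z i) (star (v i) * t) : ℝ) * Complex.I) := by
    intro z
    rw [← Complex.exp_sum, ← Finset.sum_mul, dotProduct, sum_inner]
    push_cast
    simp_rw [hin]
  simp_rw [h1, hin]
  rw [integral_fintype_prod_eq_prod
    (f := fun i (g : ℂ) => Complex.exp ((inner ℝ g (star (v i) * t) : ℝ) * Complex.I))]
  simp_rw [← charFun_apply, charFun_stdComplexGaussian]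
  rw [← Complex.exp_sum]
  congr 1
  simp only [← Complex.ofReal_neg]
  rw [← Complex.ofReal_sum]
  congr 1
  simp only [norm_mul, norm_star, mul_pow, Complex.norm_real, Real.norm_eq_abs, sq_abs]
  rw [Real.sq_sqrt (by positivity), Finset.sum_mul, Finset.sum_div, Finset.sum_neg_distrib]

/-- Rotation invariance: the characteristic function depends only on the modulus. This removes the
phase of `a` later. -/
theorem map_mul_stdComplexGaussian {c : ℂ} (hc : ‖c‖ = 1) :
    stdComplexGaussian.map (fun g => c * g) = stdComplexGaussian := by
  have : IsProbabilityMeasure (stdComplexGaussian.map fun g => c * g) :=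
    Measure.isProbabilityMeasure_map (by fun_prop)
  apply Measure.ext_of_charFun
  ext t
  have hin : ∀ g, inner ℝ (c * g) t = inner ℝ g (star c * t) := by
    intro g
    simp [Complex.inner]
    ring
  rw [charFun_apply, integral_map (by fun_prop) (by fun_prop)]
  simp_rw [hin]
  rw [← charFun_apply, charFun_stdComplexGaussian, charFun_stdComplexGaussian]
  simp [hc]

/-! ### The Bessel function `I₀` and the Rician tail -/

theorem integral_cos_pow_odd (k : ℕ) :
    ∫ θ in (-Real.pi)..Real.pi, Real.cos θ ^ (2 * k + 1) = 0 := by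
  induction k with
  | zero => simp
  | succ k ih =>
    rw [show 2 * (k + 1) + 1 = (2 * k + 1) + 2 by ring, integral_cos_pow, ih]
    simp

theorem integral_cos_pow_even (k : ℕ) :
    ∫ θ in (-Real.pi)..Real.pi, Real.cos θ ^ (2 * k) =
      2 * Real.pi * ((2 * k).factorial / (4 ^ k * (k.factorial : ℝ) ^ 2)) := by
  induction k with
  | zero => simp; ring
  | succ k ih =>
    rw [show 2 * (k + 1) = (2 * k) + 2 by ring, integral_cos_pow, ih, Nat.factorial_succ,
      Nat.factorial_succ, Nat.factorial_succ]
    have : (k.factorial : ℝ) ≠ 0 := by positivity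
    simp
    field_simp
    ring

/-- Expand `exp (x cos θ)` in powers of `x` and integrate termwise; odd powers of the cosine
integrate to zero and even ones give the Wallis integrals. -/
theorem hasSum_besselI0 (x : ℝ) :
    HasSum (fun k : ℕ => (x / 2) ^ (2 * k) / (k.factorial : ℝ) ^ 2)
      ((2 * Real.pi)⁻¹ * ∫ θ in (-Real.pi)..Real.pi, Real.exp (x * Real.cos θ)) := by
  have h : HasSum (fun n : ℕ => ∫ θ in (-Real.pi)..Real.pi, (x * Real.cos θ) ^ n / n.factorial)
      (∫ θ in (-Real.pi)..Real.pi, Real.exp (x * Real.cos θ)) := by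
    refine intervalIntegral.hasSum_integral_of_dominated_convergence
      (fun n _ => |x| ^ n / n.factorial) ?_ ?_ ?_ ?_ ?_
    · intro n
      exact Continuous.aestronglyMeasurable (by fun_prop)
    · intro n
      refine ae_of_all _ fun θ _ => ?_
      rw [norm_div, norm_pow, Real.norm_eq_abs, abs_mul, RCLike.norm_natCast]
      gcongr
      exact mul_le_of_le_one_right (abs_nonneg _) (Real.abs_cos_le_one _)
    · exact ae_of_all _ fun θ _ => Real.summable_pow_div_factorial _
    · simp
    · refine ae_of_all _ fun θ _ => ?_
      rw [Real.exp_eq_exp_ℝ]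
      exact NormedSpace.expSeries_div_hasSum_exp _
  have h' : HasSum (fun k : ℕ =>
      ∫ θ in (-Real.pi)..Real.pi, (x * Real.cos θ) ^ (2 * k) / (2 * k).factorial)
      (∫ θ in (-Real.pi)..Real.pi, Real.exp (x * Real.cos θ)) := by
    rw [← (mul_right_injective₀ (two_ne_zero (α := ℕ))).hasSum_iff] at h
    · exact h
    · intro n hn
      obtain ⟨k, rfl⟩ | ⟨k, rfl⟩ := Nat.even_or_odd n
      · exact absurd ⟨k, by simp; ring⟩ hn
      · simp_rw [mul_pow, mul_div_right_comm]
        rw [intervalIntegral.integral_const_mul, integral_cos_pow_odd, mul_zero]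
  refine (h'.mul_left (2 * Real.pi)⁻¹).congr_fun ?_
  intro k
  simp_rw [mul_pow, mul_div_right_comm]
  rw [intervalIntegral.integral_const_mul, integral_cos_pow_even]
  have h1 : (k.factorial : ℝ) ≠ 0 := by positivity
  have h2 : ((2 * k).factorial : ℝ) ≠ 0 := by positivity
  have h3 : (2 : ℝ) ^ (2 * k) = 4 ^ k := by rw [pow_mul]; norm_num
  rw [div_pow, h3]
  have := Real.pi_ne_zero
  field_simp

theorem besselI0_eq_integral (x : ℝ) :
    besselI0 x =
      (2 * Real.pi)⁻¹ * ∫ θ in (-Real.pi)..Real.pi, Real.exp (x * Real.cos θ) :=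
  (hasSum_besselI0 x).tsum_eq

theorem besselI0_zero : besselI0 0 = 1 := by
  rw [besselI0_eq_integral]
  have := Real.pi_ne_zero
  simp
  field_simp
  ring

theorem besselI0_nonneg (x : ℝ) : 0 ≤ besselI0 x :=
  tsum_nonneg fun k => by rw [pow_mul]; positivity

theorem continuous_besselI0 : Continuous besselI0 := by
  have : besselI0 = fun x =>
      (2 * Real.pi)⁻¹ * ∫ θ in (-Real.pi)..Real.pi, Real.exp (x * Real.cos θ) :=
    funext besselI0_eq_integral
  rw [this]
  refine continuous_const.mul ?_
  exact intervalIntegral.continuous_parametric_intervalIntegral_of_continuous'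
    (by fun_prop) _ _

theorem ofReal_besselI0 (x : ℝ) :
    ENNReal.ofReal (besselI0 x) = ENNReal.ofReal (2 * Real.pi)⁻¹ *
      ∫⁻ θ in Set.Ioo (-Real.pi) Real.pi, ENNReal.ofReal (Real.exp (x * Real.cos θ)) := by
  rw [besselI0_eq_integral, ENNReal.ofReal_mul (by positivity),
    intervalIntegral.integral_of_le (by linarith [Real.pi_pos]), integral_Ioc_eq_integral_Ioo,
    ofReal_integral_eq_lintegral_ofReal]
  · exact (Continuous.integrableOn_Icc (by fun_prop)).mono_set Set.Ioo_subset_Icc_self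
  · exact ae_of_all _ fun _ => (Real.exp_pos _).le

/-- The tail of a noncentral complex Gaussian modulus, in polar coordinates. -/
theorem stdComplexGaussian_tail_eq_lintegral (ν t : ℝ) (ht : 0 ≤ t) :
    stdComplexGaussian {g : ℂ | t < ‖(ν : ℂ) + g‖} =
      ∫⁻ r in Set.Ioi t, ENNReal.ofReal (2 * r) *
        ENNReal.ofReal (Real.exp (-r ^ 2 - ν ^ 2) * besselI0 (2 * (ν * r))) := by
  have hms : MeasurableSet {g : ℂ | t < ‖(ν : ℂ) + g‖} :=
    measurableSet_lt measurable_const (by fun_prop)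
  have hms' : MeasurableSet {w : ℂ | t < ‖w‖} := measurableSet_lt measurable_const (by fun_prop)
  rw [stdComplexGaussian_eq_withDensity, withDensity_apply _ hms, ← lintegral_indicator hms]
  have h1 : ∀ g : ℂ, {g : ℂ | t < ‖(ν : ℂ) + g‖}.indicator
      (fun z : ℂ => ENNReal.ofReal (Real.pi⁻¹ * Real.exp (-‖z‖ ^ 2))) g =
      (fun w : ℂ => {w : ℂ | t < ‖w‖}.indicator
        (fun w => ENNReal.ofReal (Real.pi⁻¹ * Real.exp (-‖w - ν‖ ^ 2))) w) (ν + g) := by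
    intro g
    simp [Set.indicator]
  simp_rw [h1]
  -- Translating by `ν` centres the excluded disc at the origin, so the region becomes `r > t` in
  -- polar coordinates and the angular integral is that of `I₀`.
  rw [lintegral_add_left_eq_self (fun w : ℂ => {w : ℂ | t < ‖w‖}.indicator
        (fun w => ENNReal.ofReal (Real.pi⁻¹ * Real.exp (-‖w - ν‖ ^ 2))) w) (ν : ℂ),
    ← Complex.lintegral_comp_polarCoord_symm]
  have htar : polarCoord.target = Set.Ioi (0 : ℝ) ×ˢ Set.Ioo (-Real.pi) Real.pi := rfl
  have hmeas : Measurable fun p : ℝ × ℝ => ENNReal.ofReal p.1 • {w : ℂ | t < ‖w‖}.indicator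
      (fun w => ENNReal.ofReal (Real.pi⁻¹ * Real.exp (-‖w - ν‖ ^ 2)))
        (Complex.polarCoord.symm p) := by
    refine (measurable_fst.ennreal_ofReal : Measurable fun p : ℝ × ℝ => _).smul ?_
    have hf : Measurable fun w : ℂ => ENNReal.ofReal (Real.pi⁻¹ * Real.exp (-‖w - ν‖ ^ 2)) := by
      fun_prop
    have hp : Measurable fun p : ℝ × ℝ => Complex.polarCoord.symm p := by
      simp_rw [Complex.polarCoord_symm_apply]
      fun_prop
    exact (hf.indicator hms').comp hp
  rw [htar, Measure.volume_eq_prod, ← Measure.prod_restrict,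
    lintegral_prod _ hmeas.aemeasurable, ← lintegral_indicator measurableSet_Ioi,
    ← lintegral_indicator measurableSet_Ioi]
  refine lintegral_congr fun r => ?_
  by_cases hr : t < r
  swap
  · rw [Set.indicator_of_notMem (s := Set.Ioi t) hr]
    by_cases h0 : 0 < r
    swap
    · rw [Set.indicator_of_notMem (s := Set.Ioi 0) h0]
    · rw [Set.indicator_of_mem (s := Set.Ioi 0) h0]
      simp only [Set.indicator, Set.mem_ofPred_eq, Complex.norm_polarCoord_symm, abs_of_pos h0, hr]
      simp
  have h0 : 0 < r := ht.trans_lt hr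
  rw [Set.indicator_of_mem (s := Set.Ioi 0) h0, Set.indicator_of_mem (s := Set.Ioi t) hr,
    ENNReal.ofReal_mul (Real.exp_pos _).le, ofReal_besselI0, ← mul_assoc, ← mul_assoc,
    ← lintegral_const_mul _ (Measurable.ennreal_ofReal (Continuous.measurable (by fun_prop)))]
  refine lintegral_congr fun θ => ?_
  rw [Set.indicator_of_mem (by simpa [abs_of_pos h0] using hr), smul_eq_mul,
    ← ENNReal.ofReal_mul (by positivity), ← ENNReal.ofReal_mul (by positivity),
    ← ENNReal.ofReal_mul (by positivity), ← ENNReal.ofReal_mul (by positivity)]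
  congr 1
  have hn : ‖Complex.polarCoord.symm (r, θ) - ν‖ ^ 2 =
      r ^ 2 + ν ^ 2 - 2 * (ν * r) * Real.cos θ := by
    rw [← Complex.normSq_eq_norm_sq, Complex.polarCoord_symm_apply, Complex.normSq_apply]
    simp only [Complex.sub_re, Complex.mul_re, Complex.ofReal_re, Complex.add_re, Complex.I_re,
      Complex.mul_im, Complex.ofReal_im, Complex.add_im, Complex.I_im, Complex.sub_im]
    linear_combination r ^ 2 * Real.sin_sq_add_cos_sq θ
  rw [hn, show -(r ^ 2 + ν ^ 2 - 2 * (ν * r) * Real.cos θ) =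
    (-r ^ 2 - ν ^ 2) + 2 * (ν * r) * Real.cos θ by ring, Real.exp_add]
  have := Real.pi_ne_zero
  field_simp

/-- The substitution `z = r²` turns the defining integral of `Q` into the polar form of the Gaussian
tail. -/
theorem marcumQ_sq {τ ν : ℝ} (hτ : 0 ≤ τ) (hν : 0 ≤ ν) :
    marcumQ τ (ν ^ 2) = stdComplexGaussian.real {g : ℂ | √τ < ‖(ν : ℂ) + g‖} := by
  have himg : (fun r : ℝ => r ^ 2) '' Set.Ioi (√τ) = Set.Ioi τ := by
    ext z
    constructor
    · rintro ⟨r, hr, rfl⟩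
      exact (Real.sqrt_lt' ((Real.sqrt_nonneg _).trans_lt hr)).1 hr
    · intro hz
      exact ⟨√z, Real.sqrt_lt_sqrt hτ hz, Real.sq_sqrt (hτ.trans hz.le)⟩
  rw [Measure.real, stdComplexGaussian_tail_eq_lintegral _ _ (Real.sqrt_nonneg _), marcumQ,
    integral_eq_lintegral_of_nonneg_ae
      (ae_of_all _ fun z => mul_nonneg (Real.exp_pos _).le (besselI0_nonneg _))
      (Continuous.aestronglyMeasurable
        (by have := continuous_besselI0; fun_prop)), ← himg,
    lintegral_image_eq_lintegral_abs_deriv_mul measurableSet_Ioi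
      (f' := fun r => 2 * r) (fun r _ => by simpa using (hasDerivAt_pow 2 r).hasDerivWithinAt)
      (fun r hr r' hr' h => (pow_left_inj₀ ((Real.sqrt_nonneg _).trans hr.le)
        ((Real.sqrt_nonneg _).trans hr'.le) two_ne_zero).1 h)]
  congr 1
  refine setLIntegral_congr_fun measurableSet_Ioi fun r hr => ?_
  have hr0 : 0 ≤ r := (Real.sqrt_nonneg _).trans (le_of_lt hr)
  rw [abs_of_nonneg (by positivity), ← mul_pow, Real.sqrt_sq (by positivity)]

theorem stdComplexGaussian_tail_zero {t : ℝ} (ht : 0 ≤ t) :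
    stdComplexGaussian.real {g : ℂ | t < ‖g‖} = Real.exp (-t ^ 2) := by
  have h := marcumQ_sq (sq_nonneg t) le_rfl
  rw [Real.sqrt_sq ht] at h
  simp only [Complex.ofReal_zero, zero_add] at h
  rw [← h, marcumQ]
  simp [besselI0_zero, integral_exp_Iic]

/-! ### Gaussian probabilities of discs -/

/-- The Gaussian mass `P(‖ν + s⁻¹ g‖ ≤ T)`, `g ∼ CN(0, 1)`, as an integral over a fixed disc. -/
noncomputable def discMass (T ν s : ℝ) : ℝ :=
  ∫ w in Metric.closedBall (0 : ℂ) T, Real.pi⁻¹ * s ^ 2 * Real.exp (-(s * ‖w - ν‖) ^ 2)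

theorem continuous_discMass (T : ℝ) : Continuous fun x : ℝ × ℝ => discMass T x.1 x.2 := by
  unfold discMass
  exact continuous_parametric_integral_of_continuous (by fun_prop) (isCompact_closedBall _ _)

theorem discMass_zero (ν s : ℝ) : discMass 0 ν s = 0 := by
  simp [discMass]

/-- The substitution `w = ν + σ g` moves both parameters from the domain into the integrand; over a
fixed compact disc, joint continuity in `ν` and `σ⁻¹` is immediate. -/
theorem stdComplexGaussian_disc (T ν : ℝ) {σ : ℝ} (hσ : 0 < σ) :
    stdComplexGaussian.real {g : ℂ | ‖(ν : ℂ) + σ * g‖ ≤ T} = discMass T ν σ⁻¹ := by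
  have hms : MeasurableSet {g : ℂ | ‖(ν : ℂ) + σ * g‖ ≤ T} :=
    measurableSet_le (by fun_prop) measurable_const
  let F : ℂ → ℝ := (Metric.closedBall (0 : ℂ) T).indicator
    fun w => Real.pi⁻¹ * Real.exp (-(σ⁻¹ * ‖w - ν‖) ^ 2)
  have hF : ∀ g : ℂ, {g : ℂ | ‖(ν : ℂ) + σ * g‖ ≤ T}.indicator
      (fun z : ℂ => Real.pi⁻¹ * Real.exp (-‖z‖ ^ 2)) g = F (ν + σ • g) := by
    intro g
    simp only [F, Set.indicator, Set.mem_ofPred_eq, mem_closedBall_zero_iff, Complex.real_smul]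
    congr 4
    rw [add_sub_cancel_left, norm_mul, Complex.norm_real, Real.norm_of_nonneg hσ.le,
      inv_mul_cancel_left₀ hσ.ne']
  rw [Measure.real, stdComplexGaussian_eq_withDensity, withDensity_apply _ hms,
    ← integral_eq_lintegral_of_nonneg_ae (ae_of_all _ fun z => by positivity)
      (Measurable.aestronglyMeasurable (by fun_prop)), ← integral_indicator hms]
  simp_rw [hF]
  rw [Measure.integral_comp_smul volume (fun w => F (ν + w)), integral_add_left_eq_self,
    integral_indicator Metric.isClosed_closedBall.measurableSet, discMass, smul_eq_mul,
    ← integral_const_mul]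
  refine integral_congr_ae (ae_of_all _ fun w => ?_)
  simp only [Complex.finrank_real_complex]
  rw [abs_of_nonneg (by positivity), inv_pow]
  ring

theorem stdComplexGaussian_tail (T ν : ℝ) {σ : ℝ} (hσ : 0 < σ) :
    stdComplexGaussian.real {g : ℂ | T < ‖(ν : ℂ) + σ * g‖} = 1 - discMass T ν σ⁻¹ := by
  have hms : MeasurableSet {g : ℂ | ‖(ν : ℂ) + σ * g‖ ≤ T} :=
    measurableSet_le (by fun_prop) measurable_const
  rw [← stdComplexGaussian_disc T ν hσ, ← probReal_compl_eq_one_sub hms]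
  congr 1
  ext g
  simp

theorem marcumQ_sq_eq_one_sub {τ ν : ℝ} (hτ : 0 ≤ τ) (hν : 0 ≤ ν) :
    marcumQ τ (ν ^ 2) = 1 - discMass (√τ) ν 1 := by
  have h := stdComplexGaussian_tail (√τ) ν one_pos
  simp only [Complex.ofReal_one, one_mul, inv_one] at h
  rw [marcumQ_sq hτ hν, h]

/-- Reflect in the line `re w = (ν + ν') / 2`. The reflection `ρ` exchanges the two Gaussian
densities and the discs `B`, `B'`, so their difference integrates to zero over `B ∩ B'`. The rest of
`B` lies strictly on the side of `ν`, where the difference is positive. -/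
theorem discMass_lt {T ν ν' : ℝ} (hT : 0 < T) (hν : 0 ≤ ν) (hlt : ν < ν') :
    discMass T ν' 1 < discMass T ν 1 := by
  set c : ℝ := ν + ν' with hc
  have hc0 : 0 < c := by linarith
  set B := Metric.closedBall (0 : ℂ) T
  set B' := Metric.closedBall (c : ℂ) T
  set h : ℂ → ℝ := fun w =>
    Real.pi⁻¹ * Real.exp (-‖w - ν‖ ^ 2) - Real.pi⁻¹ * Real.exp (-‖w - ν'‖ ^ 2) with hh
  have hcont : Continuous h := by fun_prop
  have hint : ∀ s ⊆ B, IntegrableOn h s := fun s hs =>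
    (hcont.continuousOn.integrableOn_compact (isCompact_closedBall _ _)).mono_set hs
  have hB : MeasurableSet B := Metric.isClosed_closedBall.measurableSet
  have hB' : MeasurableSet B' := Metric.isClosed_closedBall.measurableSet
  have hdiff : discMass T ν 1 - discMass T ν' 1 = ∫ w in B, h w := by
    simp only [discMass, hh, one_pow, mul_one, one_mul]
    rw [integral_sub]
    all_goals
      refine ContinuousOn.integrableOn_compact (isCompact_closedBall _ _) ?_
      fun_prop
  let ρ : ℂ → ℂ := fun w => c - Complex.conjLIE w
  have hρ : MeasurePreserving ρ volume volume :=
    (Measure.measurePreserving_sub_left volume (c : ℂ)).comp Complex.conjLIE.measurePreserving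
  have hρρ : ∀ w, ρ (ρ w) = w := fun w => by simp [ρ]
  have hρe : MeasurableEmbedding ρ := by
    let e : ℂ ≃ᵐ ℂ := ⟨⟨ρ, ρ, hρρ, hρρ⟩, hρ.measurable, hρ.measurable⟩
    exact e.measurableEmbedding
  have hconj : ∀ (w : ℂ) (x : ℝ), ‖Complex.conjLIE w - x‖ = ‖w - x‖ := by
    intro w x
    rw [← Complex.conjLIE.norm_map (w - x), map_sub]
    simp
  have hρB : ρ ⁻¹' (B ∩ B') = B ∩ B' := by
    ext w
    have h1 : ‖ρ w‖ = ‖w - c‖ := by rw [← hconj w c, norm_sub_rev]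
    have h2 : ‖ρ w - c‖ = ‖w‖ := by simp [ρ]
    simp only [Set.mem_preimage, Set.mem_inter_iff, B, B', mem_closedBall_iff_norm,
      sub_zero, h1, h2]
    tauto
  have hanti : ∀ w, h (ρ w) = -h w := by
    intro w
    have h1 : ‖ρ w - ν‖ = ‖w - ν'‖ := by
      rw [← hconj w ν', norm_sub_rev]
      congr 1
      simp [ρ, hc]
      ring
    have h2 : ‖ρ w - ν'‖ = ‖w - ν‖ := by
      rw [← hconj w ν, norm_sub_rev]
      congr 1
      simp [ρ, hc]
      ring
    simp only [hh, h1, h2]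
    ring
  have hzero : ∫ w in B ∩ B', h w = 0 := by
    have := hρ.setIntegral_preimage_emb hρe h (B ∩ B')
    rw [hρB] at this
    simp_rw [hanti] at this
    rw [integral_neg] at this
    linarith
  have hpos : 0 < ∫ w in B \ B', h w := by
    have hp : ∀ w ∈ B \ B', 0 < h w := by
      rintro w ⟨hw, hw'⟩
      simp only [B, B', mem_closedBall_iff_norm, sub_zero, not_le] at hw hw'
      have h1 : ‖w‖ ^ 2 < ‖w - c‖ ^ 2 := by
        have := norm_nonneg w
        gcongr
        linarith
      have h2 : ‖w - ν‖ ^ 2 < ‖w - ν'‖ ^ 2 := by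
        simp only [← Complex.normSq_eq_norm_sq, Complex.normSq_apply, Complex.sub_re,
          Complex.sub_im, Complex.ofReal_re, Complex.ofReal_im, hc] at h1 ⊢
        have h3 : w.re < (ν + ν') / 2 := by nlinarith
        nlinarith
      simp only [hh]
      rw [← mul_sub]
      refine mul_pos (by positivity) (sub_pos.2 (Real.exp_lt_exp.2 (by linarith)))
    rw [setIntegral_pos_iff_support_of_nonneg_ae
      ((ae_restrict_iff' (hB.diff hB')).2 (ae_of_all _ fun w hw => (hp w hw).le))
      (hint _ Set.sdiff_subset),
      Set.inter_eq_right.2 (show B \ B' ⊆ Function.support h from fun w hw => (hp w hw).ne')]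
    have hopen : IsOpen (Metric.ball (0 : ℂ) T \ B') :=
      Metric.isOpen_ball.sdiff Metric.isClosed_closedBall
    refine (hopen.measure_pos volume ?_).trans_le
      (measure_mono (Set.sdiff_subset_sdiff_left Metric.ball_subset_closedBall))
    -- The point `-y` is within `T` of the origin, but its distance `y + c` to the centre of `B'`
    -- exceeds `T`; hence the open part has positive measure.
    obtain ⟨y, hy1, hy2⟩ := exists_between (max_lt hT (show T - c < T by linarith))
    have hy0 : 0 < y := (le_max_left _ _).trans_lt hy1
    have hyc : T - c < y := (le_max_right _ _).trans_lt hy1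
    refine ⟨((-y : ℝ) : ℂ), ?_, ?_⟩
    · rw [mem_ball_zero_iff, Complex.norm_real, norm_neg, Real.norm_of_nonneg hy0.le]
      exact hy2
    · rw [mem_closedBall_iff_norm, ← Complex.ofReal_sub, Complex.norm_real, Real.norm_eq_abs,
        abs_of_neg (by linarith)]
      linarith
  rw [← integral_inter_add_sdiff hB' (hint B le_rfl), hzero, zero_add] at hdiff
  linarith

theorem discMass_anti {T ν ν' : ℝ} (hT : 0 ≤ T) (hν : 0 ≤ ν) (hle : ν ≤ ν') :
    discMass T ν' 1 ≤ discMass T ν 1 := by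
  obtain rfl | hT := hT.eq_or_lt
  · simp [discMass_zero]
  obtain rfl | hlt := hle.eq_or_lt
  · exact le_rfl
  · exact (discMass_lt hT hν hlt).le

theorem marcumQ_sq_mono {τ ν ν' : ℝ} (hτ : 0 ≤ τ) (hν : 0 ≤ ν) (hle : ν ≤ ν') :
    marcumQ τ (ν ^ 2) ≤ marcumQ τ (ν' ^ 2) := by
  rw [marcumQ_sq_eq_one_sub hτ hν, marcumQ_sq_eq_one_sub hτ (hν.trans hle)]
  linarith [discMass_anti (Real.sqrt_nonneg τ) hν hle]

theorem continuous_marcumQ_max_sq {τ : ℝ} (hτ : 0 ≤ τ) :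
    Continuous fun ν : ℝ => marcumQ τ ((max 0 ν) ^ 2) := by
  simp_rw [fun ν : ℝ => marcumQ_sq_eq_one_sub hτ (le_max_left 0 ν)]
  exact continuous_const.sub ((continuous_discMass _).comp
    (f := fun ν : ℝ => (max 0 ν, (1 : ℝ))) (by fun_prop))

/-- Small errors of the scale are dominated by small errors of the mean, uniformly for means in a
compact interval of positive numbers. -/
theorem eventually_tail_mem_Icc {τ δ c₀ c₁ : ℝ} (hτ : 0 ≤ τ) (hδ : 0 < δ) (hδc : δ ≤ c₀) :
    ∀ᶠ σ : ℝ in 𝓝 1, ∀ ν ∈ Set.Icc c₀ c₁,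
      stdComplexGaussian.real {g : ℂ | √τ < ‖(ν : ℂ) + σ * g‖} ∈
        Set.Icc (marcumQ τ ((ν - δ) ^ 2)) (marcumQ τ ((ν + δ) ^ 2)) := by
  have key : ∀ᶠ s in 𝓝 (1 : ℝ), ∀ ν ∈ Set.Icc c₀ c₁,
      discMass (√τ) (ν + δ) 1 ≤ discMass (√τ) ν s ∧
        discMass (√τ) ν s ≤ discMass (√τ) (ν - δ) 1 := by
    -- For `τ = 0` strict monotonicity fails, but every disc mass is zero.
    obtain h0 | hpos := (Real.sqrt_nonneg τ).eq_or_lt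
    · simp [← h0, discMass_zero]
    -- At `s = 1` both inequalities are strict, hence persist near each point `(1, ν)`; compactness
    -- makes the neighbourhood of `1` uniform in `ν`.
    refine isCompact_Icc.eventually_forall_of_forall_eventually fun ν hν => ?_
    have hJ := continuous_discMass (√τ)
    have h1 : Continuous fun z : ℝ × ℝ => discMass (√τ) z.2 z.1 :=
      hJ.comp (f := fun z : ℝ × ℝ => (z.2, z.1)) (by fun_prop)
    have h2 : Continuous fun z : ℝ × ℝ => discMass (√τ) (z.2 + δ) 1 :=
      hJ.comp (f := fun z : ℝ × ℝ => (z.2 + δ, 1)) (by fun_prop)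
    have h3 : Continuous fun z : ℝ × ℝ => discMass (√τ) (z.2 - δ) 1 :=
      hJ.comp (f := fun z : ℝ × ℝ => (z.2 - δ, 1)) (by fun_prop)
    have hν0 := hν.1
    filter_upwards [h2.continuousAt.eventually_lt h1.continuousAt
        (x₀ := ((1 : ℝ), ν)) (discMass_lt hpos (by linarith) (by linarith)),
      h1.continuousAt.eventually_lt h3.continuousAt
        (x₀ := ((1 : ℝ), ν)) (discMass_lt hpos (by linarith) (by linarith))] with z hz1 hz2
    exact ⟨hz1.le, hz2.le⟩
  have hinv : Tendsto (fun σ : ℝ => σ⁻¹) (𝓝 1) (𝓝 1) := by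
    simpa using tendsto_inv₀ (one_ne_zero (α := ℝ))
  filter_upwards [hinv.eventually key, lt_mem_nhds (zero_lt_one (α := ℝ))] with σ hσ hσ0 ν hν
  have hν0 := hν.1
  rw [stdComplexGaussian_tail _ _ hσ0, marcumQ_sq_eq_one_sub hτ (by linarith),
    marcumQ_sq_eq_one_sub hτ (by linarith)]
  have := hσ ν hν
  constructor <;> linarith

/-! ### The uniform distribution on the sphere -/

theorem measurable_ofLp_sphere {k : ℕ} :
    Measurable fun v : Metric.sphere (0 : EuclideanSpace ℂ (Fin k)) 1 => WithLp.ofLp v.1 :=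
  (WithLp.measurable_ofLp 2 (Fin k → ℂ)).comp measurable_subtype_coe

theorem isProbabilityMeasure_sphereUniform {k : ℕ} (hk : 0 < k) :
    IsProbabilityMeasure (sphereUniform k) := by
  have : Nonempty (Fin k) := ⟨⟨0, hk⟩⟩
  have : Nontrivial (EuclideanSpace ℂ (Fin k)) := inferInstance
  constructor
  rw [sphereUniform, Measure.map_apply measurable_ofLp_sphere MeasurableSet.univ,
    Set.preimage_univ, Measure.smul_apply, smul_eq_mul]
  refine ENNReal.inv_mul_cancel ?_ (measure_ne_top _ _)
  exact (Measure.measure_univ_ne_zero.2 (Measure.toSphere_ne_zero _))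

theorem sphereUniform_ae_norm {k : ℕ} : ∀ᵐ v ∂sphereUniform k, ∑ i, ‖v i‖ ^ 2 = 1 := by
  rw [sphereUniform, ae_map_iff measurable_ofLp_sphere.aemeasurable
    (measurableSet_eq_fun (by fun_prop) measurable_const)]
  refine ae_of_all _ fun v => ?_
  rw [← EuclideanSpace.norm_sq_eq, mem_sphere_zero_iff_norm.1 v.2, one_pow]

open scoped Pointwise in
-- Surface measure is defined through the volume of the cone over a set, and a linear isometry
-- preserves volume and commutes with forming cones.
theorem sphereUniform_map_isometry {k : ℕ}
    (f : EuclideanSpace ℂ (Fin k) →ₗᵢ[ℝ] EuclideanSpace ℂ (Fin k)) :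
    (sphereUniform k).map (fun v => WithLp.ofLp (f (WithLp.toLp 2 v))) = sphereUniform k := by
  set g := f.toLinearIsometryEquiv rfl
  have hfm : Measurable fun v : Fin k → ℂ => WithLp.ofLp (f (WithLp.toLp 2 v)) :=
    (WithLp.measurable_ofLp 2 _).comp
      (f.continuous.measurable.comp (WithLp.measurable_toLp 2 _))
  have hsets : ∀ A : Set (EuclideanSpace ℂ (Fin k)),
      (volume : Measure (EuclideanSpace ℂ (Fin k)))
        (Set.Ioo (0 : ℝ) 1 • (g ⁻¹' A ∩ Metric.sphere 0 1)) =
      (volume : Measure (EuclideanSpace ℂ (Fin k)))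
        (Set.Ioo (0 : ℝ) 1 • (A ∩ Metric.sphere 0 1)) := by
    intro A
    have : Set.Ioo (0 : ℝ) 1 • (g ⁻¹' A ∩ Metric.sphere 0 1) =
        g.toHomeomorph.toMeasurableEquiv ⁻¹' (Set.Ioo (0 : ℝ) 1 • (A ∩ Metric.sphere 0 1)) := by
      ext x
      simp only [Set.mem_smul, Set.mem_preimage, Set.mem_inter_iff, mem_sphere_zero_iff_norm]
      constructor
      · rintro ⟨r, hr, y, ⟨hy, hy1⟩, rfl⟩
        exact ⟨r, hr, g y, ⟨hy, by simpa using hy1⟩, by simp⟩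
      · rintro ⟨r, hr, y, ⟨hy, hy1⟩, hx⟩
        refine ⟨r, hr, g.symm y, ⟨by simpa using hy, by simpa using hy1⟩, ?_⟩
        rw [← map_smul, hx]
        exact g.symm_apply_apply x
    rw [this]
    exact MeasurePreserving.measure_preimage_equiv (f := g.toHomeomorph.toMeasurableEquiv)
      g.measurePreserving _
  have hval : ∀ B : Set (Fin k → ℂ), (Subtype.val ''
      ((fun v : Metric.sphere (0 : EuclideanSpace ℂ (Fin k)) 1 => WithLp.ofLp v.1) ⁻¹' B)) =
        WithLp.ofLp ⁻¹' B ∩ Metric.sphere 0 1 := by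
    intro B
    ext x
    simp
  ext s hs
  rw [Measure.map_apply hfm hs, sphereUniform, Measure.map_apply measurable_ofLp_sphere (hfm hs),
    Measure.map_apply measurable_ofLp_sphere hs, Measure.smul_apply, Measure.smul_apply,
    Measure.toSphere_apply' _ (measurable_ofLp_sphere (hfm hs)),
    Measure.toSphere_apply' _ (measurable_ofLp_sphere hs), hval, hval,
    ← hsets (WithLp.ofLp ⁻¹' s)]
  rfl

/-- The isometry of `ℂ^k` mixing the coordinates `i` and `j`. -/
noncomputable def mixIsometry {k : ℕ} {i j : Fin k} (hij : i ≠ j) {ω : ℂ} (hω : ‖ω‖ = 1) :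
    EuclideanSpace ℂ (Fin k) →ₗᵢ[ℝ] EuclideanSpace ℂ (Fin k) where
  toFun v := WithLp.toLp 2 fun l =>
    if l = i then (√2 : ℂ)⁻¹ * (v i + ω * v j)
    else if l = j then (√2 : ℂ)⁻¹ * (v i - ω * v j) else v l
  map_add' v w := by
    ext l
    simp only [PiLp.add_apply]
    split_ifs <;> ring
  map_smul' r v := by
    ext l
    simp only [PiLp.smul_apply, RingHom.id_apply, Complex.real_smul]
    split_ifs <;> ring
  norm_map' v := by
    rw [← sq_eq_sq₀ (norm_nonneg _) (norm_nonneg _), EuclideanSpace.norm_sq_eq,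
      EuclideanSpace.norm_sq_eq]
    have hj : j ∈ Finset.univ.erase i := by simp [hij.symm]
    rw [← Finset.add_sum_erase _ _ (Finset.mem_univ i), ← Finset.add_sum_erase _ _ hj,
      ← Finset.add_sum_erase _ (fun l => ‖v l‖ ^ 2) (Finset.mem_univ i),
      ← Finset.add_sum_erase _ (fun l => ‖v l‖ ^ 2) hj, ← add_assoc, ← add_assoc]
    congr 1
    · have h2 : ‖(√2 : ℂ)‖ ^ 2 = 2 := by
        rw [Complex.norm_real, Real.norm_of_nonneg (Real.sqrt_nonneg _), Real.sq_sqrt zero_le_two]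
      have hp := parallelogram_law_with_norm ℝ (v i) (ω * v j)
      simp only [LinearMap.coe_mk, AddHom.coe_mk, if_true, if_neg hij.symm, norm_mul, norm_inv,
        mul_pow, inv_pow, h2] at hp ⊢
      rw [hω] at hp
      linarith
    · refine Finset.sum_congr rfl fun l hl => ?_
      simp only [Finset.mem_erase] at hl
      simp [hl.1, hl.2.1]

/-- Invariance under these two-coordinate mixings, for a few values of `ω`, is enough to determine
all the second and fourth moments needed. -/
theorem integral_mix_sphereUniform {k : ℕ} {i j : Fin k} (hij : i ≠ j) {ω : ℂ} (hω : ‖ω‖ = 1)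
    {F : ℝ → ℝ → ℝ} (hF : Continuous (Function.uncurry F)) :
    ∫ v, F (‖v i‖ ^ 2) (‖v j‖ ^ 2) ∂sphereUniform k =
      ∫ v, F ((‖v i‖ ^ 2 + ‖v j‖ ^ 2) / 2 + (star (v i) * (ω * v j)).re)
        ((‖v i‖ ^ 2 + ‖v j‖ ^ 2) / 2 - (star (v i) * (ω * v j)).re) ∂sphereUniform k := by
  have hfm : Measurable fun v : Fin k → ℂ =>
      WithLp.ofLp (mixIsometry hij hω (WithLp.toLp 2 v)) :=
    (WithLp.measurable_ofLp 2 _).comp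
      ((mixIsometry hij hω).continuous.measurable.comp (WithLp.measurable_toLp 2 _))
  have hc : Continuous fun v : Fin k → ℂ => F (‖v i‖ ^ 2) (‖v j‖ ^ 2) :=
    hF.comp (f := fun v : Fin k → ℂ => (‖v i‖ ^ 2, ‖v j‖ ^ 2)) (by fun_prop)
  conv_lhs => rw [← sphereUniform_map_isometry (mixIsometry hij hω)]
  rw [integral_map hfm.aemeasurable hc.aestronglyMeasurable]
  refine integral_congr_ae (ae_of_all _ fun v => ?_)
  have h2 : ((√2 : ℝ)⁻¹) ^ 2 = 1 / 2 := by rw [inv_pow, Real.sq_sqrt zero_le_two, one_div]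
  have hω2 : ω.re * ω.re + ω.im * ω.im = 1 := by
    rw [← Complex.normSq_apply, Complex.normSq_eq_norm_sq, hω, one_pow]
  have hnorm : ‖((√2 : ℝ) : ℂ)⁻¹‖ ^ 2 = 1 / 2 := by
    rw [norm_inv, Complex.norm_real, Real.norm_of_nonneg (Real.sqrt_nonneg _), h2]
  have h1 : ‖((√2 : ℝ) : ℂ)⁻¹ * (v i + ω * v j)‖ ^ 2 =
      (‖v i‖ ^ 2 + ‖v j‖ ^ 2) / 2 + (star (v i) * (ω * v j)).re := by
    rw [norm_mul, mul_pow, hnorm]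
    simp only [← Complex.normSq_eq_norm_sq, Complex.normSq_apply, Complex.add_re, Complex.add_im,
      Complex.mul_re, Complex.mul_im, Complex.star_def, Complex.conj_re, Complex.conj_im]
    linear_combination (1 / 2) * ((v j).re ^ 2 + (v j).im ^ 2) * hω2
  have h3 : ‖((√2 : ℝ) : ℂ)⁻¹ * (v i - ω * v j)‖ ^ 2 =
      (‖v i‖ ^ 2 + ‖v j‖ ^ 2) / 2 - (star (v i) * (ω * v j)).re := by
    rw [norm_mul, mul_pow, hnorm]
    simp only [← Complex.normSq_eq_norm_sq, Complex.normSq_apply, Complex.sub_re, Complex.sub_im,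
      Complex.mul_re, Complex.mul_im, Complex.star_def, Complex.conj_re, Complex.conj_im]
    linear_combination (1 / 2) * ((v j).re ^ 2 + (v j).im ^ 2) * hω2
  simp only [mixIsometry, LinearIsometry.coe_mk, LinearMap.coe_mk, AddHom.coe_mk, if_true,
    if_neg hij.symm]
  rw [h1, h3]

theorem norm_le_one_of_sum_sq {k : ℕ} {v : Fin k → ℂ} (hv : ∑ i, ‖v i‖ ^ 2 = 1) (i : Fin k) :
    ‖v i‖ ≤ 1 := by
  have : ‖v i‖ ^ 2 ≤ 1 := hv ▸
    Finset.single_le_sum (f := fun i => ‖v i‖ ^ 2) (fun i _ => sq_nonneg _) (Finset.mem_univ i)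
  exact (sq_le_one_iff₀ (norm_nonneg _)).1 this

theorem integrable_sphereUniform {k : ℕ} (hk : 0 < k) {f : (Fin k → ℂ) → ℝ} (hf : Continuous f)
    {C : ℝ} (hC : ∀ v : Fin k → ℂ, (∀ i, ‖v i‖ ≤ 1) → |f v| ≤ C) :
    Integrable f (sphereUniform k) := by
  have := isProbabilityMeasure_sphereUniform hk
  refine Integrable.of_bound hf.aestronglyMeasurable C ?_
  filter_upwards [sphereUniform_ae_norm] with v hv
  exact hC v (norm_le_one_of_sum_sq hv)

theorem integrable_norm_sq_sphereUniform {k : ℕ} (i : Fin k) :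
    Integrable (fun v : Fin k → ℂ => ‖v i‖ ^ 2) (sphereUniform k) :=
  integrable_sphereUniform i.pos (by fun_prop) (C := 1) fun v hv => by
    rw [abs_of_nonneg (by positivity)]
    exact pow_le_one₀ (norm_nonneg _) (hv i)

theorem integrable_norm_sq_mul_sphereUniform {k : ℕ} (i j : Fin k) :
    Integrable (fun v : Fin k → ℂ => ‖v i‖ ^ 2 * ‖v j‖ ^ 2) (sphereUniform k) :=
  integrable_sphereUniform i.pos (by fun_prop) (C := 1) fun v hv => by
    rw [abs_of_nonneg (by positivity)]
    exact mul_le_one₀ (pow_le_one₀ (norm_nonneg _) (hv i)) (by positivity)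
      (pow_le_one₀ (norm_nonneg _) (hv j))

theorem abs_re_star_mul_le_one {z w ω : ℂ} (hω : ‖ω‖ = 1) (hz : ‖z‖ ≤ 1) (hw : ‖w‖ ≤ 1) :
    |(star z * (ω * w)).re| ≤ 1 := by
  refine (Complex.abs_re_le_norm _).trans ?_
  rw [norm_mul, norm_mul, norm_star, hω, one_mul]
  exact mul_le_one₀ hz (norm_nonneg _) hw

/-- The second output of the mixing with `ω = 1` and the first output with `ω = -1` have the same
squared modulus. -/
theorem integral_norm_sq_eq {k : ℕ} (i j : Fin k) :
    ∫ v, ‖v i‖ ^ 2 ∂sphereUniform k = ∫ v, ‖v j‖ ^ 2 ∂sphereUniform k := by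
  obtain rfl | hij := eq_or_ne i j
  · rfl
  have h1 := integral_mix_sphereUniform hij (ω := 1) (by simp) (F := fun x _ => x) (by fun_prop)
  have h2 := integral_mix_sphereUniform hij (ω := 1) (by simp) (F := fun _ y => y) (by fun_prop)
  have h3 := integral_mix_sphereUniform hij (ω := -1) (by simp) (F := fun x _ => x) (by fun_prop)
  simp only [neg_mul, mul_neg, Complex.neg_re, ← sub_eq_add_neg] at h1 h2 h3
  rw [h3, h2]

theorem integral_norm_pow_four_eq {k : ℕ} (i j : Fin k) :
    ∫ v, (‖v i‖ ^ 2) ^ 2 ∂sphereUniform k = ∫ v, (‖v j‖ ^ 2) ^ 2 ∂sphereUniform k := by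
  obtain rfl | hij := eq_or_ne i j
  · rfl
  have h2 := integral_mix_sphereUniform hij (ω := 1) (by simp) (F := fun _ y => y ^ 2)
    (by fun_prop)
  have h3 := integral_mix_sphereUniform hij (ω := -1) (by simp) (F := fun x _ => x ^ 2)
    (by fun_prop)
  simp only [neg_mul, mul_neg, Complex.neg_re, ← sub_eq_add_neg] at h2 h3
  rw [h3, h2]

/-- Apply the mixing to `(|v i|² - |v j|²)²` with `ω = 1` and `ω = I`. The images are four times the
squared real and imaginary parts of `star (v i) * v j` (up to sign), which add up to `4 |v i|² |v
j|²`. Comparing with the expanded square gives the factor two. -/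
theorem integral_norm_sq_mul_eq {k : ℕ} {i j : Fin k} (hij : i ≠ j) :
    ∫ v, (‖v i‖ ^ 2) ^ 2 ∂sphereUniform k = 2 * ∫ v, ‖v i‖ ^ 2 * ‖v j‖ ^ 2 ∂sphereUniform k := by
  have h1 := integral_mix_sphereUniform hij (ω := 1) (by simp) (F := fun x y => (x - y) ^ 2)
    (by fun_prop)
  have h2 := integral_mix_sphereUniform hij (ω := Complex.I) (by simp)
    (F := fun x y => (x - y) ^ 2) (by fun_prop)
  have hi : ∀ ω : ℂ, ‖ω‖ = 1 → Integrable (fun v : Fin k → ℂ =>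
      ((star (v i) * (ω * v j)).re) ^ 2) (sphereUniform k) := fun ω hω =>
    integrable_sphereUniform i.pos (by fun_prop) (C := 1) fun v hv => by
      rw [abs_pow]
      exact pow_le_one₀ (abs_nonneg _) (abs_re_star_mul_le_one hω (hv i) (hv j))
  have e1 : ∀ (v : Fin k → ℂ) (ω : ℂ), (((‖v i‖ ^ 2 + ‖v j‖ ^ 2) / 2 + (star (v i) * (ω * v j)).re)
      - ((‖v i‖ ^ 2 + ‖v j‖ ^ 2) / 2 - (star (v i) * (ω * v j)).re)) ^ 2 =
      4 * ((star (v i) * (ω * v j)).re) ^ 2 := fun v ω => by ring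
  simp_rw [e1, integral_const_mul] at h1 h2
  have e2 : ∀ v : Fin k → ℂ, ((star (v i) * (1 * v j)).re) ^ 2 +
      ((star (v i) * (Complex.I * v j)).re) ^ 2 = ‖v i‖ ^ 2 * ‖v j‖ ^ 2 := by
    intro v
    simp only [← Complex.normSq_eq_norm_sq, Complex.normSq_apply, one_mul,
      Complex.mul_re, Complex.mul_im, Complex.star_def, Complex.conj_re, Complex.conj_im,
      Complex.I_re, Complex.I_im]
    ring
  have h3 := integral_add (hi 1 (by simp)) (hi Complex.I (by simp))
  simp_rw [e2] at h3
  have e3 : ∫ v, (‖v i‖ ^ 2 - ‖v j‖ ^ 2) ^ 2 ∂sphereUniform k =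
      ∫ v, (‖v i‖ ^ 2) ^ 2 ∂sphereUniform k + ∫ v, (‖v j‖ ^ 2) ^ 2 ∂sphereUniform k -
        2 * ∫ v, ‖v i‖ ^ 2 * ‖v j‖ ^ 2 ∂sphereUniform k := by
    have hii := integrable_norm_sq_mul_sphereUniform i i
    have hjj := integrable_norm_sq_mul_sphereUniform j j
    simp only [← sq] at hii hjj
    have hadd : Integrable (fun v : Fin k → ℂ => (‖v i‖ ^ 2) ^ 2 + (‖v j‖ ^ 2) ^ 2)
        (sphereUniform k) := hii.add hjj
    rw [← integral_const_mul, ← integral_add hii hjj, ← integral_sub hadd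
      ((integrable_norm_sq_mul_sphereUniform i j).const_mul 2)]
    refine integral_congr_ae (ae_of_all _ fun v => ?_)
    ring
  rw [integral_norm_pow_four_eq j i] at e3
  linarith

theorem integral_norm_sq {k : ℕ} (i : Fin k) :
    ∫ v, ‖v i‖ ^ 2 ∂sphereUniform k = 1 / k := by
  have := isProbabilityMeasure_sphereUniform i.pos
  have h : ∑ j, ∫ v, ‖v j‖ ^ 2 ∂sphereUniform k = 1 := by
    rw [← integral_finsetSum _ fun j _ => integrable_norm_sq_sphereUniform j,
      integral_congr_ae (g := fun _ => (1 : ℝ)) sphereUniform_ae_norm]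
    simp
  simp_rw [fun j => integral_norm_sq_eq j i] at h
  rw [Finset.sum_const, Finset.card_univ, Fintype.card_fin, nsmul_eq_mul] at h
  have hk : (k : ℝ) ≠ 0 := Nat.cast_ne_zero.2 i.pos.ne'
  field_simp
  linarith

/-- Summing over `j` and using the unit norm gives `E |v i|² = 1 / k`; together with the ratio two
between diagonal and mixed moments this fixes both. -/
theorem integral_norm_sq_mul {k : ℕ} (i j : Fin k) :
    ∫ v, ‖v i‖ ^ 2 * ‖v j‖ ^ 2 ∂sphereUniform k =
      (if i = j then 2 else 1) / (k * (k + 1)) := by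
  have hk : (k : ℝ) ≠ 0 := Nat.cast_ne_zero.2 i.pos.ne'
  have hk1 : (k : ℝ) + 1 ≠ 0 := by positivity
  set m := ∫ v, (‖v i‖ ^ 2) ^ 2 ∂sphereUniform k with hm
  have hval : ∀ l, ∫ v, ‖v i‖ ^ 2 * ‖v l‖ ^ 2 ∂sphereUniform k =
      m / 2 + if l = i then m / 2 else 0 := by
    intro l
    split_ifs with h
    · subst h
      simp_rw [← sq]
      rw [← hm]
      ring
    · rw [hm, integral_norm_sq_mul_eq (Ne.symm h)]
      ring
  have hsum : ∑ l, ∫ v, ‖v i‖ ^ 2 * ‖v l‖ ^ 2 ∂sphereUniform k = 1 / k := by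
    rw [← integral_norm_sq i, ← integral_finsetSum _ fun j _ =>
      integrable_norm_sq_mul_sphereUniform i j]
    refine integral_congr_ae ?_
    filter_upwards [sphereUniform_ae_norm] with v hv
    rw [← Finset.mul_sum, hv, mul_one]
  simp_rw [hval] at hsum
  rw [Finset.sum_add_distrib, Finset.sum_const, Finset.card_univ, Fintype.card_fin,
    Finset.sum_ite_eq' Finset.univ i, if_pos (Finset.mem_univ i), nsmul_eq_mul] at hsum
  have hm2 : m / 2 = 1 / (k * (k + 1)) := by
    field_simp at hsum ⊢
    linarith
  rw [hval, hm2]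
  by_cases h : i = j
  · rw [if_pos h.symm, if_pos h]
    ring
  · rw [if_neg (Ne.symm h), if_neg h, add_zero]

/-- With `S = ∑ l i`, the variance is `(S² + ∑ l i²) / (k (k + 1)) - S² / k²`. The `S` terms
contribute at most zero, leaving `∑ l i² / (k (k + 1))`. -/
theorem integral_diagonal_form_sq_le {k : ℕ} (hk : 0 < k) (l : Fin k → ℝ) {C : ℝ}
    (hC : ∀ i, |l i| ≤ C) :
    ∫ v, (∑ i, l i * ‖v i‖ ^ 2 - (∑ i, l i) / k) ^ 2 ∂sphereUniform k ≤ C ^ 2 / k := by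
  have := isProbabilityMeasure_sphereUniform hk
  have hk0 : (0 : ℝ) < k := Nat.cast_pos.2 hk
  set S := ∑ i, l i
  have hint1 : Integrable (fun v : Fin k → ℂ => ∑ i, ∑ j, l i * l j * (‖v i‖ ^ 2 * ‖v j‖ ^ 2))
      (sphereUniform k) :=
    integrable_finsetSum _ fun i _ => integrable_finsetSum _ fun j _ =>
      (integrable_norm_sq_mul_sphereUniform i j).const_mul _
  have hint2 : Integrable (fun v : Fin k → ℂ => ∑ i, 2 * (S / k) * l i * ‖v i‖ ^ 2)
      (sphereUniform k) :=
    integrable_finsetSum _ fun i _ => (integrable_norm_sq_sphereUniform i).const_mul _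
  have hexp : ∀ v : Fin k → ℂ, (∑ i, l i * ‖v i‖ ^ 2 - S / k) ^ 2 =
      (∑ i, ∑ j, l i * l j * (‖v i‖ ^ 2 * ‖v j‖ ^ 2) - ∑ i, 2 * (S / k) * l i * ‖v i‖ ^ 2) +
        (S / k) ^ 2 := by
    intro v
    have h1 : (∑ i, l i * ‖v i‖ ^ 2) ^ 2 = ∑ i, ∑ j, l i * l j * (‖v i‖ ^ 2 * ‖v j‖ ^ 2) := by
      rw [sq, Finset.sum_mul_sum]
      exact Finset.sum_congr rfl fun i _ => Finset.sum_congr rfl fun j _ => by ring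
    have h2 : ∑ i, 2 * (S / k) * l i * ‖v i‖ ^ 2 = 2 * (S / k) * ∑ i, l i * ‖v i‖ ^ 2 := by
      rw [Finset.mul_sum]
      exact Finset.sum_congr rfl fun i _ => by ring
    rw [← h1, h2]
    ring
  simp_rw [hexp]
  have hint12 : Integrable (fun v : Fin k → ℂ => ∑ i, ∑ j, l i * l j * (‖v i‖ ^ 2 * ‖v j‖ ^ 2) -
      ∑ i, 2 * (S / k) * l i * ‖v i‖ ^ 2) (sphereUniform k) := hint1.sub hint2
  rw [integral_add hint12 (integrable_const _), integral_sub hint1 hint2,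
    integral_finsetSum _ fun i _ => integrable_finsetSum _ fun j _ =>
      (integrable_norm_sq_mul_sphereUniform i j).const_mul _,
    integral_finsetSum _ fun i _ => (integrable_norm_sq_sphereUniform i).const_mul _]
  simp_rw [integral_finsetSum _ fun j _ =>
      (integrable_norm_sq_mul_sphereUniform _ j).const_mul _, integral_const_mul,
    integral_norm_sq, integral_norm_sq_mul]
  have h1 : ∑ i, ∑ j, l i * l j * ((if i = j then (2 : ℝ) else 1) / (k * (k + 1))) =
      (S ^ 2 + ∑ i, l i ^ 2) / (k * (k + 1)) := by
    have : ∀ i j : Fin k, l i * l j * ((if i = j then (2 : ℝ) else 1) / (k * (k + 1))) =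
        (l i * l j + if i = j then l i * l j else 0) / (k * (k + 1)) := by
      intro i j
      split_ifs <;> ring
    simp_rw [this, ← Finset.sum_div, Finset.sum_add_distrib]
    congr 2
    · rw [sq, Finset.sum_mul_sum]
    · simp [sq]
  have h2 : ∑ i, 2 * (S / k) * l i * (1 / (k : ℝ)) = 2 * (S / k) ^ 2 := by
    rw [← Finset.sum_mul, ← Finset.mul_sum]
    ring
  have h3 : ∑ i, l i ^ 2 ≤ k * C ^ 2 := by
    calc ∑ i, l i ^ 2 ≤ ∑ _i : Fin k, C ^ 2 :=
          Finset.sum_le_sum fun i _ => sq_le_sq' (abs_le.1 (hC i)).1 (abs_le.1 (hC i)).2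
      _ = k * C ^ 2 := by simp
  have hS : S ^ 2 / (k * (k + 1)) ≤ (S / k) ^ 2 := by
    rw [div_pow, sq (k : ℝ)]
    gcongr
    linarith
  have h4 : (∑ i, l i ^ 2) / (k * (k + 1)) ≤ C ^ 2 / k := by
    rw [div_le_div_iff₀ (by positivity) hk0]
    nlinarith [sq_nonneg C, mul_le_mul_of_nonneg_right h3 hk0.le, mul_nonneg (sq_nonneg C) hk0.le]
  rw [h1, h2, add_div, integral_const, probReal_univ, one_smul]
  linarith

/-! ### Quadratic forms of Hermitian matrices -/

section L2Operator

open scoped Matrix.Norms.L2Operator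

variable {k : ℕ}

theorem norm_unitary_le_one {U : Matrix (Fin k) (Fin k) ℂ}
    (hU : U ∈ Matrix.unitaryGroup (Fin k) ℂ) : ‖U‖ ≤ 1 := by
  have h : ‖U‖ * ‖U‖ ≤ 1 := by
    rw [← Matrix.l2_opNorm_conjTranspose_mul_self, ← Matrix.star_eq_conjTranspose,
      Matrix.mem_unitaryGroup_iff'.1 hU, ← Matrix.diagonal_one, Matrix.l2_opNorm_diagonal]
    exact (pi_norm_le_iff_of_nonneg zero_le_one).2 fun i => by simp
  nlinarith [norm_nonneg U]

theorem abs_eigenvalues_le {A : Matrix (Fin k) (Fin k) ℂ} (hA : A.IsHermitian) (i : Fin k) :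
    |hA.eigenvalues i| ≤ specNorm A := by
  have hU := hA.eigenvectorUnitary.2
  have h := hA.conjStarAlgAut_star_eigenvectorUnitary
  rw [Unitary.conjStarAlgAut_apply] at h
  have h1 := congrArg norm h
  rw [Matrix.l2_opNorm_diagonal] at h1
  have h2 : |hA.eigenvalues i| ≤ ‖(RCLike.ofReal ∘ hA.eigenvalues : Fin k → ℂ)‖ := by
    have := norm_le_pi_norm (RCLike.ofReal ∘ hA.eigenvalues : Fin k → ℂ) i
    simpa using this
  refine h2.trans (h1 ▸ ?_)
  refine (norm_mul_le _ _).trans ?_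
  refine (mul_le_of_le_one_right (norm_nonneg _) ?_).trans ?_
  · rw [norm_star]
    exact norm_unitary_le_one (star hA.eigenvectorUnitary).2
  · refine (norm_mul_le _ _).trans (mul_le_of_le_one_left (norm_nonneg _) ?_)
    exact norm_unitary_le_one (star hA.eigenvectorUnitary).2

end L2Operator

variable {k : ℕ}

theorem star_dotProduct_self (v : Fin k → ℂ) : star v ⬝ᵥ v = ((∑ i, ‖v i‖ ^ 2 : ℝ) : ℂ) := by
  rw [dotProduct]
  push_cast
  refine Finset.sum_congr rfl fun i _ => ?_
  rw [Pi.star_apply, Complex.star_def, Complex.conj_mul']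

theorem sum_norm_sq_mulVec_of_unitary {U : Matrix (Fin k) (Fin k) ℂ}
    (hU : U ∈ Matrix.unitaryGroup (Fin k) ℂ) (v : Fin k → ℂ) :
    ∑ i, ‖(U *ᵥ v) i‖ ^ 2 = ∑ i, ‖v i‖ ^ 2 := by
  have h : star (U *ᵥ v) ⬝ᵥ (U *ᵥ v) = star v ⬝ᵥ v := by
    rw [Matrix.star_mulVec, ← Matrix.dotProduct_mulVec, Matrix.mulVec_mulVec,
      ← Matrix.star_eq_conjTranspose, Matrix.mem_unitaryGroup_iff'.1 hU, Matrix.one_mulVec]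
  rw [star_dotProduct_self, star_dotProduct_self] at h
  exact_mod_cast h

/-- A Hermitian quadratic form in the coordinates of an eigenbasis. -/
theorem star_dotProduct_mulVec_eq {A : Matrix (Fin k) (Fin k) ℂ} (hA : A.IsHermitian)
    (v : Fin k → ℂ) :
    star v ⬝ᵥ (A *ᵥ v) = ((∑ i, hA.eigenvalues i *
      ‖((star hA.eigenvectorUnitary : Matrix (Fin k) (Fin k) ℂ) *ᵥ v) i‖ ^ 2 : ℝ) : ℂ) := by
  set U : Matrix (Fin k) (Fin k) ℂ := hA.eigenvectorUnitary.1 with hU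
  have h : A = U * Matrix.diagonal (RCLike.ofReal ∘ hA.eigenvalues) * star U := by
    conv_lhs => rw [hA.spectral_theorem, Unitary.conjStarAlgAut_apply]
  conv_lhs => rw [h, ← Matrix.mulVec_mulVec, ← Matrix.mulVec_mulVec, Matrix.dotProduct_mulVec]
  have hs : star v ᵥ* U = star (star U *ᵥ v) := by
    rw [Matrix.star_mulVec, Matrix.star_eq_conjTranspose, Matrix.conjTranspose_conjTranspose]
  rw [hs]
  set w := star U *ᵥ v
  rw [dotProduct]
  push_cast
  refine Finset.sum_congr rfl fun i _ => ?_
  rw [Matrix.mulVec_diagonal, Pi.star_apply, Complex.star_def, ← Complex.conj_mul']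
  simp only [Function.comp_apply, Complex.coe_algebraMap]
  ring

theorem quadForm_le {A : Matrix (Fin k) (Fin k) ℂ} (hA : A.IsHermitian) (v : Fin k → ℂ) :
    (star v ⬝ᵥ (A *ᵥ v)).re ≤ specNorm A * ∑ i, ‖v i‖ ^ 2 := by
  rw [star_dotProduct_mulVec_eq hA, Complex.ofReal_re,
    ← sum_norm_sq_mulVec_of_unitary (star hA.eigenvectorUnitary).2 v, Finset.mul_sum]
  refine Finset.sum_le_sum fun i _ => ?_
  exact mul_le_mul_of_nonneg_right ((le_abs_self _).trans (abs_eigenvalues_le hA i)) (by positivity)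

theorem le_quadForm {A : Matrix (Fin k) (Fin k) ℂ} (hA : A.IsHermitian)
    {c : ℝ} (hc : c ∈ lowerBounds (spectrum ℝ A)) (v : Fin k → ℂ) :
    c * ∑ i, ‖v i‖ ^ 2 ≤ (star v ⬝ᵥ (A *ᵥ v)).re := by
  rw [star_dotProduct_mulVec_eq hA, Complex.ofReal_re,
    ← sum_norm_sq_mulVec_of_unitary (star hA.eigenvectorUnitary).2 v, Finset.mul_sum]
  refine Finset.sum_le_sum fun i _ => ?_
  exact mul_le_mul_of_nonneg_right (hc (hA.eigenvalues_mem_spectrum_real i)) (by positivity)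

theorem sphereUniform_map_unitary {U : Matrix (Fin k) (Fin k) ℂ}
    (hU : U ∈ Matrix.unitaryGroup (Fin k) ℂ) :
    (sphereUniform k).map (fun v => U *ᵥ v) = sphereUniform k := by
  let f : EuclideanSpace ℂ (Fin k) →ₗᵢ[ℝ] EuclideanSpace ℂ (Fin k) :=
    { toFun := fun v => WithLp.toLp 2 (U *ᵥ WithLp.ofLp v)
      map_add' := fun v w => by simp [Matrix.mulVec_add]
      map_smul' := fun r v => by simp [Matrix.mulVec_smul]
      norm_map' := fun v => by
        rw [← sq_eq_sq₀ (norm_nonneg _) (norm_nonneg _), EuclideanSpace.norm_sq_eq,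
          EuclideanSpace.norm_sq_eq]
        exact sum_norm_sq_mulVec_of_unitary hU _ }
  exact sphereUniform_map_isometry f

/-- Concentration of Hermitian quadratic forms of a vector that is uniform on the sphere. -/
theorem integral_quadForm_sub_trace_sq_le (hk : 0 < k) {A : Matrix (Fin k) (Fin k) ℂ}
    (hA : A.IsHermitian) {C : ℝ} (hC : specNorm A ≤ C) :
    ∫ v, ((star v ⬝ᵥ (A *ᵥ v)).re - A.trace.re / k) ^ 2 ∂sphereUniform k ≤ C ^ 2 / k := by
  have hUm : Measurable fun v : Fin k → ℂ =>
      (star hA.eigenvectorUnitary : Matrix (Fin k) (Fin k) ℂ) *ᵥ v := Continuous.measurable (by fun_prop)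
  have htr : A.trace.re = ∑ i, hA.eigenvalues i := by
    rw [hA.trace_eq_sum_eigenvalues]
    simp
  have h := integral_diagonal_form_sq_le hk hA.eigenvalues
    (fun i => (abs_eigenvalues_le hA i).trans hC)
  rw [← sphereUniform_map_unitary (star hA.eigenvectorUnitary).2, Unitary.coe_star,
    integral_map hUm.aemeasurable (Continuous.aestronglyMeasurable (by fun_prop))] at h
  simp_rw [star_dotProduct_mulVec_eq hA, Complex.ofReal_re, htr]
  exact h

theorem integrable_quadForm_sub_trace_sq (hk : 0 < k) {A : Matrix (Fin k) (Fin k) ℂ}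
    (c : ℝ) :
    Integrable (fun v => ((star v ⬝ᵥ (A *ᵥ v)).re - c) ^ 2) (sphereUniform k) := by
  refine integrable_sphereUniform hk (by fun_prop)
    (C := (∑ i, ∑ j, ‖A i j‖ + |c|) ^ 2) fun v hv => ?_
  rw [abs_pow]
  gcongr
  refine (abs_sub _ _).trans ?_
  gcongr
  refine (Complex.abs_re_le_norm _).trans ?_
  rw [dotProduct]
  refine (norm_sum_le _ _).trans (Finset.sum_le_sum fun i _ => ?_)
  rw [norm_mul, Pi.star_apply, norm_star]
  refine (mul_le_of_le_one_left (norm_nonneg _) (hv i)).trans ?_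
  rw [Matrix.mulVec, dotProduct]
  refine (norm_sum_le _ _).trans (Finset.sum_le_sum fun j _ => ?_)
  rw [norm_mul]
  exact mul_le_of_le_one_right (norm_nonneg _) (hv j)

/-! ### The Frobenius norm and normalized traces -/

section Frobenius

open scoped Matrix.Norms.L2Operator

variable {k : ℕ}

/-- The squared Frobenius norm. -/
noncomputable def frobSq (A : Matrix (Fin k) (Fin k) ℂ) : ℝ := ∑ i, ∑ j, ‖A i j‖ ^ 2

theorem frobSq_nonneg (A : Matrix (Fin k) (Fin k) ℂ) : 0 ≤ frobSq A := by
  unfold frobSq; positivity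

theorem frobSq_conjTranspose (A : Matrix (Fin k) (Fin k) ℂ) : frobSq Aᴴ = frobSq A := by
  rw [frobSq, frobSq, Finset.sum_comm]
  simp

/-- Each column of `A * B` is `A` applied to a column of `B`. -/
theorem frobSq_mul_le (A B : Matrix (Fin k) (Fin k) ℂ) :
    frobSq (A * B) ≤ ‖A‖ ^ 2 * frobSq B := by
  rw [frobSq, frobSq, Finset.sum_comm, Finset.sum_comm (f := fun i j => ‖B i j‖ ^ 2),
    Finset.mul_sum]
  refine Finset.sum_le_sum fun j _ => ?_
  have h := Matrix.l2_opNorm_mulVec A (WithLp.toLp 2 fun i => B i j)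
  have h2 := pow_le_pow_left₀ (norm_nonneg _) h 2
  rw [mul_pow, EuclideanSpace.norm_sq_eq, EuclideanSpace.norm_sq_eq] at h2
  exact h2

theorem frobSq_mul_le' (A B : Matrix (Fin k) (Fin k) ℂ) :
    frobSq (A * B) ≤ frobSq A * ‖B‖ ^ 2 := by
  rw [← frobSq_conjTranspose, Matrix.conjTranspose_mul, mul_comm, ← frobSq_conjTranspose A,
    ← Matrix.l2_opNorm_conjTranspose B]
  exact frobSq_mul_le _ _

theorem frobSq_le (A : Matrix (Fin k) (Fin k) ℂ) : frobSq A ≤ k * ‖A‖ ^ 2 := by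
  have h := frobSq_mul_le A 1
  have h1 : frobSq (1 : Matrix (Fin k) (Fin k) ℂ) = k := by
    simp [frobSq, Matrix.one_apply, apply_ite]
  rw [mul_one, h1] at h
  linarith

theorem norm_trace_mul_sq_le (A B : Matrix (Fin k) (Fin k) ℂ) :
    ‖(A * B).trace‖ ^ 2 ≤ frobSq A * frobSq B := by
  have h1 : ‖(A * B).trace‖ ≤ ∑ x : Fin k × Fin k, ‖A x.1 x.2‖ * ‖B x.2 x.1‖ := by
    rw [Matrix.trace, Fintype.sum_prod_type]
    refine (norm_sum_le _ _).trans (Finset.sum_le_sum fun i _ => ?_)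
    rw [Matrix.diag_apply, Matrix.mul_apply]
    refine (norm_sum_le _ _).trans (Finset.sum_le_sum fun j _ => ?_)
    rw [norm_mul]
  have h2 := Finset.sum_mul_sq_le_sq_mul_sq (Finset.univ : Finset (Fin k × Fin k))
    (fun x => ‖A x.1 x.2‖) (fun x => ‖B x.2 x.1‖)
  refine (pow_le_pow_left₀ (norm_nonneg _) h1 2).trans (h2.trans_eq ?_)
  rw [Fintype.sum_prod_type, Fintype.sum_prod_type, frobSq, frobSq,
    Finset.sum_comm (f := fun i j => ‖B i j‖ ^ 2)]

/-- Cauchy–Schwarz for the trace pairing. Both Frobenius norms carry a factor `√k`, which matches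
the normalization of traces by `k`. -/
theorem norm_trace_mul_le {A : Matrix (Fin k) (Fin k) ℂ} {e : ℝ} (he : 0 ≤ e)
    (hA : frobSq A ≤ k * e ^ 2) (B : Matrix (Fin k) (Fin k) ℂ) :
    ‖(A * B).trace‖ ≤ k * (e * ‖B‖) := by
  have h : ‖(A * B).trace‖ ^ 2 ≤ (k * (e * ‖B‖)) ^ 2 := by
    refine (norm_trace_mul_sq_le A B).trans ?_
    calc frobSq A * frobSq B ≤ (k * e ^ 2) * (k * ‖B‖ ^ 2) :=
          mul_le_mul hA (frobSq_le B) (frobSq_nonneg B) (by positivity)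
      _ = (k * (e * ‖B‖)) ^ 2 := by ring
  exact (sq_le_sq₀ (norm_nonneg _) (by positivity)).1 h

/-- Near an oracle matrix, the normalized traces of `P⁻¹ R P⁻¹` and of `P⁻¹` nearly agree with
the normalized trace of the inverse oracle. -/
theorem exists_trace_approx {R U P : Matrix (Fin k) (Fin k) ℂ} (hk : 0 < k) (hR : R.PosDef)
    (hR1 : 1 ∈ lowerBounds (spectrum ℝ R)) {M : ℝ} (hM : specNorm R ≤ M)
    (hU : U ∈ Matrix.unitaryGroup (Fin k) ℂ) (hP : P.PosDef) {C e : ℝ}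
    (hC : specNorm P⁻¹ ≤ C) (he : 0 ≤ e) (hloss : frobLoss P (oracleMatrix R U) ≤ e ^ 2) :
    ∃ b : ℝ, 1 / M ≤ b ∧ b ≤ 1 ∧ |P⁻¹.trace.re / k - b| ≤ C * e ∧
      |(P⁻¹ * R * P⁻¹).trace.re / k - b| ≤ C * M * (C + 1) * e := by
  have hk0 : (0 : ℝ) < k := Nat.cast_pos.2 hk
  have hUU : Uᴴ * U = 1 := Matrix.mem_unitaryGroup_iff'.1 hU
  have hUU' : U * Uᴴ = 1 := Matrix.mem_unitaryGroup_iff.1 hU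
  set r : Fin k → ℝ := fun i => (star (U.col i) ⬝ᵥ (R *ᵥ U.col i)).re with hr
  have hrc : ∀ i, star (U.col i) ⬝ᵥ (R *ᵥ U.col i) = (r i : ℂ) := by
    intro i
    simp only [hr]
    rw [star_dotProduct_mulVec_eq hR.1, Complex.ofReal_re]
  have hcol : ∀ i, ∑ l, ‖U.col i l‖ ^ 2 = 1 := by
    intro i
    have h : star (U.col i) ⬝ᵥ U.col i = (Uᴴ * U) i i := by
      rw [Matrix.mul_apply]
      rfl
    rw [hUU, Matrix.one_apply_eq, star_dotProduct_self] at h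
    exact_mod_cast h
  -- The `r i` are Rayleigh quotients of unit vectors, hence lie in `[1, M]`.
  have hr1 : ∀ i, 1 ≤ r i := fun i => by
    have := le_quadForm hR.1 hR1 (U.col i)
    rwa [hcol, mul_one] at this
  have hrM : ∀ i, r i ≤ M := fun i => by
    have := quadForm_le hR.1 (U.col i)
    rw [hcol, mul_one] at this
    exact this.trans hM
  have hM1 : 1 ≤ M := (hr1 ⟨0, hk⟩).trans (hrM _)
  have hC0 : 0 ≤ C := (norm_nonneg _).trans hC
  set D : Matrix (Fin k) (Fin k) ℂ := Matrix.diagonal fun i => ((r i)⁻¹ : ℂ) with hD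
  set B : Matrix (Fin k) (Fin k) ℂ := U * D * Uᴴ with hB
  set A := P⁻¹ with hA
  have hO : oracleMatrix R U = U * Matrix.diagonal (fun i => (r i : ℂ)) * Uᴴ := by
    simp only [oracleMatrix, hrc]
  have hOB : oracleMatrix R U * B = 1 := by
    have hdd : Matrix.diagonal (fun i => (r i : ℂ)) * D = 1 := by
      rw [hD, Matrix.diagonal_mul_diagonal, ← Matrix.diagonal_one]
      congr 1
      ext i
      exact mul_inv_cancel₀ (Complex.ofReal_ne_zero.2 (by linarith [hr1 i]))
    calc oracleMatrix R U * B
        = U * (Matrix.diagonal (fun i => (r i : ℂ)) * ((Uᴴ * U) * D)) * Uᴴ := by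
          rw [hO, hB]
          simp only [Matrix.mul_assoc]
      _ = 1 := by rw [hUU, Matrix.one_mul, hdd, Matrix.mul_one, hUU']
  have hAP : A * P = 1 := Matrix.nonsing_inv_mul _ ((Matrix.isUnit_iff_isUnit_det _).1 hP.isUnit)
  have hBnorm : ‖B‖ ≤ 1 := by
    have hDn : ‖D‖ ≤ 1 := by
      rw [hD, Matrix.l2_opNorm_diagonal]
      refine (pi_norm_le_iff_of_nonneg zero_le_one).2 fun i => ?_
      rw [norm_inv, Complex.norm_real, Real.norm_of_nonneg (by linarith [hr1 i])]
      exact inv_le_one_of_one_le₀ (hr1 i)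
    have hU1 := norm_unitary_le_one hU
    have hU2 : ‖Uᴴ‖ ≤ 1 := by rwa [Matrix.l2_opNorm_conjTranspose]
    calc ‖B‖ ≤ ‖U‖ * ‖D‖ * ‖Uᴴ‖ :=
          (norm_mul_le _ _).trans (mul_le_mul_of_nonneg_right (norm_mul_le _ _) (norm_nonneg _))
      _ ≤ 1 * 1 * 1 := by gcongr
      _ = 1 := by norm_num
  -- Resolvent identity for the inverses `A` of `P` and `B` of the oracle: bounded operator norms of
  -- `A` and `B` transfer the Frobenius bound to `A - B`.
  have hAB : A - B = A * (oracleMatrix R U - P) * B := by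
    rw [Matrix.mul_sub, hAP, Matrix.sub_mul, Matrix.mul_assoc, hOB, Matrix.mul_one, Matrix.one_mul]
  have hfr : frobSq (A - B) ≤ k * (C * e) ^ 2 := by
    have h1 : frobSq (oracleMatrix R U - P) ≤ k * e ^ 2 := by
      have h2 : frobLoss P (oracleMatrix R U) = (k : ℝ)⁻¹ * frobSq (oracleMatrix R U - P) := by
        simp only [frobLoss, frobSq, Matrix.sub_apply, norm_sub_rev]
      rw [h2, inv_mul_le_iff₀ hk0] at hloss
      exact hloss
    rw [hAB]
    calc frobSq (A * (oracleMatrix R U - P) * B)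
        ≤ (‖A‖ ^ 2 * frobSq (oracleMatrix R U - P)) * ‖B‖ ^ 2 :=
          (frobSq_mul_le' _ _).trans
            (mul_le_mul_of_nonneg_right (frobSq_mul_le _ _) (by positivity))
      _ ≤ (C ^ 2 * (k * e ^ 2)) * 1 ^ 2 := by
          have := frobSq_nonneg (oracleMatrix R U - P)
          have hAC : ‖A‖ ≤ C := hC
          gcongr
      _ = k * (C * e) ^ 2 := by ring
  have hBtr : B.trace = ((∑ i, (r i)⁻¹ : ℝ) : ℂ) := by
    rw [hB, Matrix.trace_mul_comm, ← Matrix.mul_assoc, hUU, Matrix.one_mul, hD,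
      Matrix.trace_diagonal]
    push_cast
    rfl
  -- The defining property of the oracle: in the basis `U` the trace of `B² R` only sees the
  -- diagonal entries `r i` of `U' R U`, and `(r i)⁻² * r i = (r i)⁻¹`.
  have hBBR : (B * B * R).trace = B.trace := by
    have h1 : B * B * R = U * (D * D * (Uᴴ * R)) := by
      calc B * B * R = U * (D * ((Uᴴ * U) * D * (Uᴴ * R))) := by
            rw [hB]
            simp only [Matrix.mul_assoc]
        _ = _ := by rw [hUU, Matrix.one_mul, Matrix.mul_assoc]
    rw [h1, Matrix.trace_mul_comm, Matrix.mul_assoc, hBtr, hD, Matrix.diagonal_mul_diagonal,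
      Matrix.trace]
    push_cast
    refine Finset.sum_congr rfl fun i _ => ?_
    have h2 : (Uᴴ * R * U) i i = (r i : ℂ) := by
      rw [← hrc, Matrix.mul_assoc, Matrix.mul_apply]
      rfl
    rw [Matrix.diag_apply, Matrix.diagonal_mul, h2, mul_assoc,
      inv_mul_cancel₀ (Complex.ofReal_ne_zero.2 (by linarith [hr1 i])), mul_one]
  have hCe : 0 ≤ C * e := by positivity
  have hRn : ‖R‖ ≤ M := hM
  have hAn : ‖A‖ ≤ C := hC
  have hre : ∀ z w : ℂ, |z.re / k - w.re / k| ≤ ‖z - w‖ / k := by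
    intro z w
    rw [← sub_div, abs_div, abs_of_pos hk0, ← Complex.sub_re]
    gcongr
    exact Complex.abs_re_le_norm _
  refine ⟨B.trace.re / k, ?_, ?_, ?_, ?_⟩
  · rw [hBtr, Complex.ofReal_re, le_div_iff₀ hk0]
    calc 1 / M * k = ∑ _i : Fin k, 1 / M := by simp [mul_comm]
      _ ≤ ∑ i, (r i)⁻¹ := Finset.sum_le_sum fun i _ => by
          rw [one_div]
          exact inv_anti₀ (by linarith [hr1 i]) (hrM i)
  · rw [hBtr, Complex.ofReal_re, div_le_one hk0]
    calc ∑ i, (r i)⁻¹ ≤ ∑ _i : Fin k, (1 : ℝ) :=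
          Finset.sum_le_sum fun i _ => inv_le_one_of_one_le₀ (hr1 i)
      _ = k := by simp
  · refine (hre _ _).trans ?_
    rw [div_le_iff₀ hk0, ← Matrix.trace_sub]
    have h := norm_trace_mul_le hCe hfr 1
    have h1 : ‖(1 : Matrix (Fin k) (Fin k) ℂ)‖ ≤ 1 := norm_unitary_le_one (one_mem _)
    rw [Matrix.mul_one] at h
    nlinarith [mul_le_mul_of_nonneg_left h1 (mul_nonneg hk0.le hCe)]
  · refine (hre _ _).trans ?_
    -- Telescoping by cyclicity of the trace, so that `A - B` appears once in each term.
    have hsplit : (A * R * A).trace - B.trace =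
        ((A - B) * (R * A)).trace + ((A - B) * (B * R)).trace := by
      have e1 : (A * R * A).trace = (A * (R * A)).trace := by rw [Matrix.mul_assoc]
      have e2 : (B * (R * A)).trace = (A * (B * R)).trace := by
        rw [← Matrix.mul_assoc, Matrix.trace_mul_comm]
      have e3 : (B * (B * R)).trace = B.trace := by rw [← Matrix.mul_assoc, hBBR]
      rw [Matrix.sub_mul, Matrix.sub_mul, Matrix.trace_sub, Matrix.trace_sub, e1, e2, e3]
      ring
    rw [div_le_iff₀ hk0, hsplit]
    have h1 := norm_trace_mul_le hCe hfr (R * A)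
    have h2 := norm_trace_mul_le hCe hfr (B * R)
    have n1 : ‖R * A‖ ≤ M * C := (norm_mul_le _ _).trans (by gcongr)
    have n2 : ‖B * R‖ ≤ 1 * M := (norm_mul_le _ _).trans (by gcongr)
    calc ‖((A - B) * (R * A)).trace + ((A - B) * (B * R)).trace‖
        ≤ k * (C * e * ‖R * A‖) + k * (C * e * ‖B * R‖) := (norm_add_le _ _).trans (add_le_add h1 h2)
      _ ≤ k * (C * e * (M * C)) + k * (C * e * (1 * M)) := by gcongr
      _ = C * M * (C + 1) * e * k := by ring

end Frobenius

/-! ### Concentration of the quadratic forms of the detector -/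

/-- Chebyshev's inequality. -/
theorem sphereUniform_quadForm_ge_le {k : ℕ} (hk : 0 < k) {A : Matrix (Fin k) (Fin k) ℂ}
    (hA : A.IsHermitian) {C ε : ℝ} (hC : specNorm A ≤ C) (hε : 0 < ε) :
    sphereUniform k {v | ε ≤ |(star v ⬝ᵥ (A *ᵥ v)).re - A.trace.re / k|} ≤
      ENNReal.ofReal (C ^ 2 / (k * ε ^ 2)) := by
  have := isProbabilityMeasure_sphereUniform hk
  have hk0 : (0 : ℝ) < k := Nat.cast_pos.2 hk
  have h := mul_meas_ge_le_integral_of_nonneg (μ := sphereUniform k)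
    (f := fun v => ((star v ⬝ᵥ (A *ᵥ v)).re - A.trace.re / k) ^ 2)
    (ae_of_all _ fun v => sq_nonneg _) (integrable_quadForm_sub_trace_sq hk _) (ε ^ 2)
  have hset : {v : Fin k → ℂ | ε ≤ |(star v ⬝ᵥ (A *ᵥ v)).re - A.trace.re / k|} =
      {v | ε ^ 2 ≤ ((star v ⬝ᵥ (A *ᵥ v)).re - A.trace.re / k) ^ 2} := by
    ext v
    simp only [Set.mem_ofPred_eq]
    rw [sq_le_sq, abs_of_pos hε]
  rw [hset, ← ENNReal.ofReal_toReal (measure_ne_top (sphereUniform k) _)]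
  refine ENNReal.ofReal_le_ofReal ?_
  have h2 := h.trans (integral_quadForm_sub_trace_sq_le hk hA hC)
  rw [le_div_iff₀ (by positivity)]
  rw [le_div_iff₀ hk0, Measure.real] at h2
  linarith

variable {Ω : Type*} [MeasurableSpace Ω] {μ : Measure Ω} [IsProbabilityMeasure μ]

/-! ### Measurability of matrix expressions -/

theorem measurable_mulVec_of {α : Type*} [MeasurableSpace α] {k m : ℕ}
    {A : α → Matrix (Fin k) (Fin m) ℂ} {v : α → Fin m → ℂ} (hA : Measurable A)
    (hv : Measurable v) : Measurable fun ω => A ω *ᵥ v ω := by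
  refine measurable_pi_lambda _ fun i => ?_
  simp only [Matrix.mulVec, dotProduct]
  refine Finset.measurable_fun_sum _ fun j _ => Measurable.mul ?_ ?_
  · exact (measurable_pi_apply j).comp ((measurable_pi_apply i).comp hA)
  · exact (measurable_pi_apply j).comp hv

theorem measurable_star_dotProduct_of {α : Type*} [MeasurableSpace α] {k : ℕ}
    {u v : α → Fin k → ℂ} (hu : Measurable u) (hv : Measurable v) :
    Measurable fun ω => star (u ω) ⬝ᵥ v ω := by
  simp only [dotProduct, Pi.star_apply]
  refine Finset.measurable_fun_sum _ fun j _ => Measurable.mul ?_ ?_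
  · exact (continuous_star.measurable).comp ((measurable_pi_apply j).comp hu)
  · exact (measurable_pi_apply j).comp hv

theorem measurable_trace_of {α : Type*} [MeasurableSpace α] {k : ℕ}
    {A : α → Matrix (Fin k) (Fin k) ℂ} (hA : Measurable A) : Measurable fun ω => (A ω).trace := by
  simp only [Matrix.trace, Matrix.diag_apply]
  exact Finset.measurable_fun_sum _ fun j _ =>
    (measurable_pi_apply j).comp ((measurable_pi_apply j).comp hA)

theorem borelSpace_matrix (k : ℕ) : BorelSpace (Matrix (Fin k) (Fin k) ℂ) :=
  inferInstanceAs (BorelSpace (Fin k → Fin k → ℂ))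

theorem measurable_inv_of {α : Type*} [MeasurableSpace α] {k : ℕ}
    {A : α → Matrix (Fin k) (Fin k) ℂ} (hA : Measurable A) : Measurable fun ω => (A ω)⁻¹ := by
  have := borelSpace_matrix k
  have h1 : Measurable fun B : Matrix (Fin k) (Fin k) ℂ => B.det :=
    Continuous.measurable (by fun_prop)
  have h2 : Measurable fun B : Matrix (Fin k) (Fin k) ℂ => B.adjugate :=
    Continuous.measurable (by fun_prop)
  have h3 : Measurable fun B : Matrix (Fin k) (Fin k) ℂ => B⁻¹ := by
    simp only [Matrix.inv_def, Ring.inverse_eq_inv']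
    refine measurable_pi_lambda _ fun i => measurable_pi_lambda _ fun j => ?_
    exact h1.inv.mul ((measurable_pi_apply j).comp ((measurable_pi_apply i).comp h2))
  exact h3.comp hA

theorem measurable_sandwich_of {α : Type*} [MeasurableSpace α] {k : ℕ}
    {A : α → Matrix (Fin k) (Fin k) ℂ} (hA : Measurable A) (R : Matrix (Fin k) (Fin k) ℂ) :
    Measurable fun ω => A ω * R * A ω := by
  have := borelSpace_matrix k
  have h : Measurable fun B : Matrix (Fin k) (Fin k) ℂ => B * R * B :=
    Continuous.measurable (by fun_prop)
  exact h.comp hA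

/-- By independence the joint law is a product, so the bound for a fixed matrix applies at almost
every value of `X` and is then integrated. -/
theorem measure_quadForm_ge_le {k : ℕ} (hk : 0 < k) {β : Type*} [MeasurableSpace β]
    {s : Ω → Fin k → ℂ} {X : Ω → β} (hsm : Measurable s) (hXm : Measurable X)
    (hs : HasLaw s (sphereUniform k) μ) (hsX : IndepFun s X μ)
    {A : β → Matrix (Fin k) (Fin k) ℂ} (hAm : Measurable A) (hA : ∀ Y, (A Y).IsHermitian)
    {C ε : ℝ} (hC : ∀ᵐ ω ∂μ, specNorm (A (X ω)) ≤ C) (hε : 0 < ε) :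
    μ {ω | ε ≤ |(star (s ω) ⬝ᵥ (A (X ω) *ᵥ s ω)).re - (A (X ω)).trace.re / k|} ≤
      ENNReal.ofReal (C ^ 2 / (k * ε ^ 2)) := by
  have := isProbabilityMeasure_sphereUniform hk
  set E : Set ((Fin k → ℂ) × β) :=
    {z | ε ≤ |(star z.1 ⬝ᵥ (A z.2 *ᵥ z.1)).re - (A z.2).trace.re / k|} with hE
  have hAm' : Measurable fun z : (Fin k → ℂ) × β => A z.2 := hAm.comp measurable_snd
  have hEm : MeasurableSet E := by
    refine measurableSet_le measurable_const ?_
    refine Measurable.abs (Measurable.sub ?_ ?_)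
    · exact Complex.measurable_re.comp
        (measurable_star_dotProduct_of measurable_fst (measurable_mulVec_of hAm' measurable_fst))
    · exact (Complex.measurable_re.comp (measurable_trace_of hAm')).div_const _
  have hlaw : μ.map (fun ω => (s ω, X ω)) = (sphereUniform k).prod (μ.map X) := by
    rw [(indepFun_iff_map_prod_eq_prod_map_map hsm.aemeasurable hXm.aemeasurable).1 hsX, hs.map_eq]
  have : IsProbabilityMeasure (μ.map X) := Measure.isProbabilityMeasure_map hXm.aemeasurable
  change μ ((fun ω => (s ω, X ω)) ⁻¹' E) ≤ _
  rw [← Measure.map_apply (hsm.prodMk hXm) hEm, hlaw, Measure.prod_apply_symm hEm,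
    lintegral_map (measurable_measure_prodMk_right hEm) hXm]
  calc ∫⁻ ω, sphereUniform k ((fun v => (v, X ω)) ⁻¹' E) ∂μ
      ≤ ∫⁻ _ω, ENNReal.ofReal (C ^ 2 / (k * ε ^ 2)) ∂μ := by
        refine lintegral_mono_ae ?_
        filter_upwards [hC] with ω hω
        exact sphereUniform_quadForm_ge_le hk (hA _) hω hε
    _ = ENNReal.ofReal (C ^ 2 / (k * ε ^ 2)) := by simp

theorem tendsto_ofReal_div_natCast {p : ℕ → ℕ} (hp : Tendsto p atTop atTop) (c ε : ℝ) :
    Tendsto (fun n => ENNReal.ofReal (c / (p n * ε))) atTop (𝓝 0) := by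
  have h1 : Tendsto (fun n => (c / ε) / (p n : ℝ)) atTop (𝓝 0) :=
    (tendsto_natCast_atTop_atTop.comp hp).const_div_atTop _
  have h2 := ENNReal.tendsto_ofReal h1
  simp only [ENNReal.ofReal_zero] at h2
  refine h2.congr fun n => ?_
  rw [div_div, mul_comm ε]

theorem tendsto_atTop_of_ratio {p : ℕ → ℕ} {γ : ℝ} (hγ : 0 < γ)
    (hp : Tendsto (fun n : ℕ => (p n : ℝ) / (n : ℝ)) atTop (𝓝 γ)) : Tendsto p atTop atTop := by
  rw [← tendsto_natCast_atTop_iff (R := ℝ)]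
  refine (hp.pos_mul_atTop hγ tendsto_natCast_atTop_atTop).congr' ?_
  filter_upwards [eventually_gt_atTop 0] with n hn
  exact div_mul_cancel₀ _ (Nat.cast_ne_zero.2 hn.ne')

/-- The event that the normalized signal power `s' P⁻¹ s` is of order one and the normalized noise
power `s' P⁻¹ R P⁻¹ s` is close to it. -/
def goodSet {k : ℕ} (M ε : ℝ) (R : Matrix (Fin k) (Fin k) ℂ) :
    Set ((Fin k → ℂ) × Matrix (Fin k) (Fin k) ℂ) :=
  {z | 1 / M - ε ≤ (star z.1 ⬝ᵥ (z.2⁻¹ *ᵥ z.1)).re ∧ (star z.1 ⬝ᵥ (z.2⁻¹ *ᵥ z.1)).re ≤ 1 + ε ∧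
    |(star z.1 ⬝ᵥ ((z.2⁻¹ * R * z.2⁻¹) *ᵥ z.1)).re - (star z.1 ⬝ᵥ (z.2⁻¹ *ᵥ z.1)).re| ≤ ε}

theorem measurableSet_goodSet {k : ℕ} (M ε : ℝ) (R : Matrix (Fin k) (Fin k) ℂ) :
    MeasurableSet (goodSet M ε R) := by
  have hi : Measurable fun z : (Fin k → ℂ) × Matrix (Fin k) (Fin k) ℂ => z.2⁻¹ :=
    measurable_inv_of measurable_snd
  have h1 : Measurable fun z : (Fin k → ℂ) × Matrix (Fin k) (Fin k) ℂ =>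
      (star z.1 ⬝ᵥ (z.2⁻¹ *ᵥ z.1)).re :=
    Complex.measurable_re.comp
      (measurable_star_dotProduct_of measurable_fst (measurable_mulVec_of hi measurable_fst))
  have h2 : Measurable fun z : (Fin k → ℂ) × Matrix (Fin k) (Fin k) ℂ =>
      (star z.1 ⬝ᵥ ((z.2⁻¹ * R * z.2⁻¹) *ᵥ z.1)).re :=
    Complex.measurable_re.comp (measurable_star_dotProduct_of measurable_fst
      (measurable_mulVec_of (measurable_sandwich_of hi R) measurable_fst))
  exact (measurableSet_le measurable_const h1).inter ((measurableSet_le h1 measurable_const).inter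
    (measurableSet_le (h2.sub h1).abs measurable_const))

theorem isHermitian_sandwich {k : ℕ} {A R : Matrix (Fin k) (Fin k) ℂ} (hA : A.IsHermitian)
    (hR : R.IsHermitian) : (A * R * A).IsHermitian := by
  rw [Matrix.IsHermitian, Matrix.conjTranspose_mul, Matrix.conjTranspose_mul, hA.eq, hR.eq,
    Matrix.mul_assoc]

theorem tendsto_measure_compl_goodSet {p : ℕ → ℕ} (hp : Tendsto p atTop atTop)
    {M : ℝ} {R : ∀ n, Matrix (Fin (p n)) (Fin (p n)) ℂ}
    (hR : ∀ n, 1 ≤ n → (R n).PosDef)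
    (hR_min : ∀ n, 1 ≤ n → IsLeast (spectrum ℝ (R n)) 1)
    (hR_norm : ∀ n, 1 ≤ n → specNorm (R n) = M)
    {s : ∀ n, Ω → Fin (p n) → ℂ} {X : ∀ n, Ω → Matrix (Fin (p n)) (Fin n) ℂ}
    (hs_meas : ∀ n, 1 ≤ n → Measurable (s n)) (hX_meas : ∀ n, 1 ≤ n → Measurable (X n))
    (hs : ∀ n, 1 ≤ n → HasLaw (s n) (sphereUniform (p n)) μ)
    (hsX : ∀ n, 1 ≤ n → IndepFun (s n) (X n) μ)
    {Rhat : ∀ n, Matrix (Fin (p n)) (Fin n) ℂ → Matrix (Fin (p n)) (Fin (p n)) ℂ}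
    (hRhat : IsOracleConsistent μ R X Rhat) {ε : ℝ} (hε : 0 < ε) :
    Tendsto (fun n => μ {ω | (s n ω, Rhat n (X n ω)) ∉ goodSet M ε (R n)}) atTop (𝓝 0) := by
  obtain ⟨hshr, Rstar, horacle, hloss⟩ := hRhat
  obtain ⟨C₀, hC₀⟩ := hshr.inv_bounded
  set C : ℝ := max C₀ 0 with hCdef
  have hCnn : 0 ≤ C := le_max_right _ _
  have hM0 : 0 ≤ M := hR_norm 1 le_rfl ▸ norm_nonneg _
  -- With this `e`, each normalized trace is within `ε / 4` of `b`; each quadratic form is within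
  -- another `ε / 4` of its trace. So both forms are within `ε / 2` of `b`, hence within `ε` of each
  -- other.
  obtain ⟨e, he, he1, he2⟩ : ∃ e : ℝ, 0 < e ∧ C * e ≤ ε / 4 ∧ C * M * (C + 1) * e ≤ ε / 4 := by
    refine ⟨ε / 4 / (C + C * M * (C + 1) + 1), by positivity, ?_, ?_⟩
    all_goals
      rw [← mul_div_assoc, div_le_iff₀ (by positivity), mul_comm]
      refine mul_le_mul_of_nonneg_left ?_ (by positivity)
      have : 0 ≤ C * M * (C + 1) := by positivity
      linarith
  have hε4 : 0 < ε / 4 := by positivity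
  have hl := hloss (ENNReal.ofReal (e ^ 2)) (ENNReal.ofReal_pos.2 (by positivity))
  have h1 := tendsto_ofReal_div_natCast hp (C ^ 2) ((ε / 4) ^ 2)
  have h2 := tendsto_ofReal_div_natCast hp ((C * M * C) ^ 2) ((ε / 4) ^ 2)
  have hsum := (hl.add h1).add h2
  simp only [add_zero] at hsum
  refine tendsto_of_tendsto_of_tendsto_of_le_of_le' tendsto_const_nhds hsum
    (Eventually.of_forall fun n => zero_le) ?_
  filter_upwards [eventually_ge_atTop 1, hp.eventually_ge_atTop 1] with n hn hpn
  have hinv : ∀ Y, ((Rhat n Y)⁻¹).IsHermitian := fun Y => (hshr.posDef n hn Y).inv.1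
  have hCn : ∀ᵐ ω ∂μ, specNorm (Rhat n (X n ω))⁻¹ ≤ C := by
    filter_upwards [hC₀] with ω hω using (hω n hn).trans (le_max_left _ _)
  have hCn2 : ∀ᵐ ω ∂μ, specNorm ((Rhat n (X n ω))⁻¹ * R n * (Rhat n (X n ω))⁻¹) ≤ C * M * C := by
    filter_upwards [hCn] with ω hω
    have hmul : ∀ A B : Matrix (Fin (p n)) (Fin (p n)) ℂ,
        specNorm (A * B) ≤ specNorm A * specNorm B := fun A B => by
      rw [specNorm, map_mul]
      exact norm_mul_le _ _
    have hnn : ∀ A : Matrix (Fin (p n)) (Fin (p n)) ℂ, 0 ≤ specNorm A := fun A => norm_nonneg _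
    refine (hmul _ _).trans (mul_le_mul ((hmul _ _).trans ?_) hω (hnn _) (by positivity))
    exact mul_le_mul hω (hR_norm n hn).le (hnn _) hCnn
  have hAm := measurable_inv_of (hshr.measurable n hn)
  have b1 := measure_quadForm_ge_le hpn (hs_meas n hn) (hX_meas n hn) (hs n hn) (hsX n hn)
    hAm hinv hCn hε4
  have b2 := measure_quadForm_ge_le hpn (hs_meas n hn) (hX_meas n hn) (hs n hn) (hsX n hn)
    (measurable_sandwich_of hAm (R n)) (fun Y => isHermitian_sandwich (hinv Y) (hR n hn).1)
    hCn2 hε4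
  obtain ⟨U, -, hU⟩ := horacle n hn
  -- Union bound: failure requires a large Frobenius loss or a large deviation of one of the two
  -- quadratic forms.
  refine le_trans (measure_mono_ae ?_)
    ((measure_union_le _ _).trans (add_le_add ((measure_union_le _ _).trans
      (add_le_add le_rfl b1)) b2))
  filter_upwards [hU, hCn] with ω hUω hCω hω
  by_contra hcon
  have hcon' : ¬ ((ENNReal.ofReal (e ^ 2) ≤ edist (frobLoss (Rhat n (X n ω)) (Rstar n ω)) 0 ∨
      ε / 4 ≤ |(star (s n ω) ⬝ᵥ ((Rhat n (X n ω))⁻¹ *ᵥ s n ω)).re -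
        ((Rhat n (X n ω))⁻¹).trace.re / p n|) ∨
      ε / 4 ≤ |(star (s n ω) ⬝ᵥ (((Rhat n (X n ω))⁻¹ * R n * (Rhat n (X n ω))⁻¹) *ᵥ s n ω)).re -
        ((Rhat n (X n ω))⁻¹ * R n * (Rhat n (X n ω))⁻¹).trace.re / p n|) := hcon
  push Not at hcon'
  obtain ⟨⟨c1, c2⟩, c3⟩ := hcon'
  have hle : frobLoss (Rhat n (X n ω)) (oracleMatrix (R n) (U ω)) ≤ e ^ 2 := by
    rw [← hUω.2]
    rw [edist_dist, ENNReal.ofReal_lt_ofReal_iff (by positivity), Real.dist_eq, sub_zero] at c1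
    exact (le_abs_self _).trans c1.le
  obtain ⟨b, hb1, hb2, hb3, hb4⟩ := exists_trace_approx hpn (hR n hn) (hR_min n hn).2
    (hR_norm n hn).le hUω.1.1 (hshr.posDef n hn (X n ω)) hCω he.le hle
  apply hω
  simp only [goodSet, Set.mem_ofPred_eq]
  rw [abs_lt] at c2 c3
  have hb3' := abs_le.1 (hb3.trans he1)
  have hb4' := abs_le.1 (hb4.trans he2)
  refine ⟨by linarith, by linarith, abs_le.2 ⟨by linarith, by linarith⟩⟩

/-! ### Conditional probabilities given independent data -/

/-- Independence makes the conditional law of `Z` given `W` the constant kernel `κ`, so the data can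
be frozen while `z` is integrated out. -/
theorem condProb_of_indepFun {Ω β 𝓩 : Type*} [MeasurableSpace Ω] [mβ : MeasurableSpace β]
    [MeasurableSpace 𝓩] [StandardBorelSpace 𝓩] [Nonempty 𝓩] {μ : Measure Ω}
    [IsProbabilityMeasure μ] {W : Ω → β} {Z : Ω → 𝓩} (hW : Measurable W) (hZ : Measurable Z)
    {κ : Measure 𝓩} (hκ : HasLaw Z κ μ) (hind : IndepFun Z W μ) {E : Set (β × 𝓩)}
    (hE : MeasurableSet E) :
    μ⟦{ω | (W ω, Z ω) ∈ E} | mβ.comap W⟧ =ᵐ[μ] fun ω => κ.real {z | (W ω, z) ∈ E} := by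
  have : IsProbabilityMeasure κ := hκ.map_eq ▸ Measure.isProbabilityMeasure_map hZ.aemeasurable
  have hcd : condDistrib Z W μ =ᵐ[μ.map W] Kernel.const β κ := by
    refine condDistrib_ae_eq_of_measure_eq_compProd W hZ.aemeasurable ?_
    rw [Measure.compProd_const, ← hκ.map_eq]
    exact (indepFun_iff_map_prod_eq_prod_map_map hW.aemeasurable hZ.aemeasurable).1 hind.symm
  have h := condExp_prod_ae_eq_integral_condDistrib (μ := μ) hW hZ.aemeasurable
    (f := E.indicator fun _ => (1 : ℝ)) (stronglyMeasurable_const.indicator hE)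
    (by
      have : (fun a => E.indicator (fun _ => (1 : ℝ)) (W a, Z a)) =
        ((fun a => (W a, Z a)) ⁻¹' E).indicator fun _ => (1 : ℝ) := rfl
      rw [this]
      exact (integrable_const _).indicator (hW.prodMk hZ hE))
  filter_upwards [h, ae_of_ae_map hW.aemeasurable hcd] with ω hω hcω
  refine Eq.trans hω ?_
  rw [hcω, Kernel.const_apply]
  have hsec : MeasurableSet {z | (W ω, z) ∈ E} := measurable_prodMk_left hE
  exact integral_indicator_one hsec

/-! ### The law of the test statistic -/

section Statistic

variable {k : ℕ}

theorem cfc_sqrt_mul_self {R : Matrix (Fin k) (Fin k) ℂ} (hR : R.PosSemidef) :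
    cfc Real.sqrt R * cfc Real.sqrt R = R := by
  have hsa : IsSelfAdjoint R := hR.1
  rw [← cfc_mul Real.sqrt Real.sqrt R (by fun_prop) (by fun_prop)]
  conv_rhs => rw [← cfc_id ℝ R]
  refine cfc_congr fun x hx => ?_
  rw [hR.1.spectrum_real_eq_range_eigenvalues] at hx
  obtain ⟨i, rfl⟩ := hx
  exact Real.mul_self_sqrt (hR.eigenvalues_nonneg i)

/-- With `S = R^{1/2}` self-adjoint, the functional equals `(S u)' z` for standard `z`, and `‖S u‖²
= u' R u`. -/
theorem map_star_dotProduct_complexGaussian {R : Matrix (Fin k) (Fin k) ℂ} (hR : R.PosSemidef)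
    (u : Fin k → ℂ) :
    (complexGaussian 0 R).map (fun z => star u ⬝ᵥ z) =
      stdComplexGaussian.map fun g => ((√(star u ⬝ᵥ (R *ᵥ u)).re : ℝ) : ℂ) * g := by
  set S := cfc Real.sqrt R with hS
  have hSh : Sᴴ = S := IsSelfAdjoint.cfc
  have hm : Measurable fun z : Fin k → ℂ => star u ⬝ᵥ z := Continuous.measurable (by fun_prop)
  have hm' : Measurable fun z : Fin k → ℂ => (0 : Fin k → ℂ) + S *ᵥ z :=
    Continuous.measurable (by fun_prop)
  have hsum : ∑ i, ‖(star u ᵥ* S) i‖ ^ 2 = (star u ⬝ᵥ (R *ᵥ u)).re := by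
    have h1 : star (S *ᵥ u) = star u ᵥ* S := by rw [Matrix.star_mulVec, hSh]
    have h2 : star (S *ᵥ u) ⬝ᵥ (S *ᵥ u) = star u ⬝ᵥ (R *ᵥ u) := by
      rw [h1, ← Matrix.dotProduct_mulVec, Matrix.mulVec_mulVec, cfc_sqrt_mul_self hR]
    rw [← h2, star_dotProduct_self, Complex.ofReal_re, ← h1]
    simp
  rw [complexGaussian, Measure.map_map hm hm', ← hsum, ← map_dotProduct_stdComplexGaussian]
  congr 1
  ext z
  simp [Matrix.dotProduct_mulVec]

instance (m : Fin k → ℂ) (R : Matrix (Fin k) (Fin k) ℂ) :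
    IsProbabilityMeasure (complexGaussian m R) :=
  Measure.isProbabilityMeasure_map (Continuous.aemeasurable (by fun_prop))

variable {R P : Matrix (Fin k) (Fin k) ℂ}

/-- The normalized signal amplitude `s' P⁻¹ s`. -/
noncomputable def signalForm (P : Matrix (Fin k) (Fin k) ℂ) (s : Fin k → ℂ) : ℝ :=
  (star s ⬝ᵥ (P⁻¹ *ᵥ s)).re

/-- The noise power `s' P⁻¹ R P⁻¹ s`. -/
noncomputable def noiseForm (R P : Matrix (Fin k) (Fin k) ℂ) (s : Fin k → ℂ) : ℝ :=
  (star s ⬝ᵥ ((P⁻¹ * R * P⁻¹) *ᵥ s)).re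

/-- The law of the output `s' P⁻¹ x` of the filter, up to the signal. -/
theorem map_filter_complexGaussian (hR : R.PosSemidef) (hP : P.PosDef) (s : Fin k → ℂ) :
    (complexGaussian 0 R).map (fun z => star s ⬝ᵥ (P⁻¹ *ᵥ z)) =
      stdComplexGaussian.map fun g => ((√(noiseForm R P s) : ℝ) : ℂ) * g := by
  have hPi : (P⁻¹)ᴴ = P⁻¹ := hP.inv.1
  have h1 : star (P⁻¹ *ᵥ s) = star s ᵥ* P⁻¹ := by rw [Matrix.star_mulVec, hPi]
  have h := map_star_dotProduct_complexGaussian hR (P⁻¹ *ᵥ s)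
  have h2 : star (P⁻¹ *ᵥ s) ⬝ᵥ (R *ᵥ (P⁻¹ *ᵥ s)) = star s ⬝ᵥ ((P⁻¹ * R * P⁻¹) *ᵥ s) := by
    rw [h1, ← Matrix.dotProduct_mulVec, Matrix.mulVec_mulVec, Matrix.mulVec_mulVec]
  rw [h2] at h
  rw [noiseForm, ← h]
  congr 1
  ext z
  rw [h1, Matrix.dotProduct_mulVec]

theorem filter_signal (hP : P.PosDef) (s : Fin k → ℂ) (a : ℂ) (z : Fin k → ℂ) :
    star s ⬝ᵥ (P⁻¹ *ᵥ (z + a • s)) = a * signalForm P s + star s ⬝ᵥ (P⁻¹ *ᵥ z) := by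
  have h : star s ⬝ᵥ (P⁻¹ *ᵥ s) = (signalForm P s : ℂ) := by
    rw [signalForm, star_dotProduct_mulVec_eq hP.inv.1, Complex.ofReal_re]
  rw [Matrix.mulVec_add, Matrix.mulVec_smul, dotProduct_add, dotProduct_smul, h, smul_eq_mul,
    add_comm]

theorem nuHat_eq (hP : P.PosDef) (s : Fin k → ℂ) (a : ℂ) (z : Fin k → ℂ) :
    nuHat s P (z + a • s) =
      ‖a * signalForm P s + star s ⬝ᵥ (P⁻¹ *ᵥ z)‖ / √(signalForm P s) := by
  rw [nuHat, filter_signal hP, signalForm]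

theorem amfStat_eq_nuHat_sq (s : Fin k → ℂ) (hD : 0 ≤ signalForm P s) (x : Fin k → ℂ) :
    amfStat s P x = nuHat s P x ^ 2 := by
  rw [nuHat, amfStat, div_pow, ← signalForm, Real.sq_sqrt hD]

theorem nuHat_nonneg (s : Fin k → ℂ) (x : Fin k → ℂ) : 0 ≤ nuHat s P x := by
  unfold nuHat; positivity

theorem filter_measurable (P : Matrix (Fin k) (Fin k) ℂ) (s : Fin k → ℂ) :
    Measurable fun z : Fin k → ℂ => star s ⬝ᵥ (P⁻¹ *ᵥ z) :=
  Continuous.measurable (by fun_prop)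

/-- The conditional detection rate. -/
theorem complexGaussian_lt_amfStat (hR : R.PosSemidef) (hP : P.PosDef) {s : Fin k → ℂ}
    (hD : 0 < signalForm P s) {τ : ℝ} (hτ : 0 ≤ τ) (a : ℂ) :
    (complexGaussian 0 R).real {z | τ < amfStat s P (z + a • s)} =
      stdComplexGaussian.real {g : ℂ | √τ < ‖((‖a‖ * √(signalForm P s) : ℝ) : ℂ) +
        (√(noiseForm R P s / signalForm P s) : ℝ) * g‖} := by
  set D := signalForm P s
  set N := noiseForm R P s
  have hsD : 0 < √D := Real.sqrt_pos.2 hD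
  -- The phase of `a`; replacing `g` by `c * g` leaves its law unchanged and lets `c` be factored
  -- out of the modulus.
  obtain ⟨c, hc, hca⟩ : ∃ c : ℂ, ‖c‖ = 1 ∧ a = c * ‖a‖ := by
    refine ⟨Complex.exp (a.arg * Complex.I), by simp [Complex.norm_exp_ofReal_mul_I], ?_⟩
    rw [mul_comm]
    exact (Complex.norm_mul_exp_arg_mul_I a).symm
  have hset : {z | τ < amfStat s P (z + a • s)} =
      (fun z => star s ⬝ᵥ (P⁻¹ *ᵥ z)) ⁻¹' {y : ℂ | √τ < ‖a * D + y‖ / √D} := by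
    ext z
    simp only [Set.mem_preimage, Set.mem_ofPred_eq]
    rw [amfStat_eq_nuHat_sq s hD.le, ← nuHat_eq hP, Real.sqrt_lt hτ (nuHat_nonneg _ _)]
  have hms : MeasurableSet {y : ℂ | √τ < ‖a * D + y‖ / √D} :=
    measurableSet_lt measurable_const (by fun_prop)
  have hmul : Measurable fun g : ℂ => ((√N : ℝ) : ℂ) * g := by fun_prop
  have hmulc : Measurable fun g : ℂ => c * g := by fun_prop
  rw [hset, ← map_measureReal_apply (filter_measurable P s) hms,
    map_filter_complexGaussian hR hP, map_measureReal_apply hmul hms,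
    ← map_mul_stdComplexGaussian hc, map_measureReal_apply hmulc (hmul hms),
    map_mul_stdComplexGaussian hc]
  congr 1
  ext g
  simp only [Set.mem_preimage, Set.mem_ofPred_eq]
  have h1 : a * D + (√N : ℝ) * (c * g) =
      c * √D * (((‖a‖ * √D : ℝ) : ℂ) + (√(N / D) : ℝ) * g) := by
    have h2 : ((√D : ℝ) : ℂ) * (√D : ℝ) = D := by
      rw [← Complex.ofReal_mul, Real.mul_self_sqrt hD.le]
    have h3 : ((√D : ℝ) : ℂ) * (√(N / D) : ℝ) = (√N : ℝ) := by
      rw [← Complex.ofReal_mul, Real.sqrt_div' _ hD.le, mul_div_cancel₀ _ hsD.ne']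
    rw [← h2, ← h3]
    conv_lhs => rw [hca]
    push_cast
    ring
  rw [h1, norm_mul, norm_mul, hc, one_mul, Complex.norm_real, Real.norm_of_nonneg hsD.le,
    mul_div_cancel_left₀ _ hsD.ne']

/-- Concentration of `ν̂` around its value without noise. -/
theorem le_complexGaussian_abs_nuHat_sub (hR : R.PosSemidef) (hP : P.PosDef) {s : Fin k → ℂ}
    (hD : 0 < signalForm P s) (hN : 0 < noiseForm R P s)
    (a : ℂ) {t : ℝ} (ht : 0 ≤ t) :
    1 - Real.exp (-(t / √(noiseForm R P s / signalForm P s)) ^ 2) ≤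
      (complexGaussian 0 R).real
        {z | |nuHat s P (z + a • s) - ‖a‖ * √(signalForm P s)| ≤ t} := by
  set D := signalForm P s
  set N := noiseForm R P s
  have hsD : 0 < √D := Real.sqrt_pos.2 hD
  have hsN : 0 < √N := Real.sqrt_pos.2 hN
  -- The event `|√N g| ≤ t √D` is `|g| ≤ T`; by the reverse triangle inequality it forces `ν̂` to be
  -- within `t` of its noiseless value.
  set T := t / √(N / D) with hT
  have hT0 : 0 ≤ T := by positivity
  have hTe : T * √N = t * √D := by
    rw [hT, Real.sqrt_div' _ hD.le]
    field_simp
  have hms : MeasurableSet {y : ℂ | ‖y‖ ≤ t * √D} :=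
    measurableSet_le (by fun_prop) measurable_const
  have hmul : Measurable fun g : ℂ => ((√N : ℝ) : ℂ) * g := by fun_prop
  have hms' : MeasurableSet {g : ℂ | T < ‖g‖} := measurableSet_lt measurable_const (by fun_prop)
  have h1 : 1 - Real.exp (-T ^ 2) = (complexGaussian 0 R).real
      ((fun z => star s ⬝ᵥ (P⁻¹ *ᵥ z)) ⁻¹' {y : ℂ | ‖y‖ ≤ t * √D}) := by
    rw [← map_measureReal_apply (filter_measurable P s) hms, map_filter_complexGaussian hR hP,
      map_measureReal_apply hmul hms, ← stdComplexGaussian_tail_zero hT0,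
      ← probReal_compl_eq_one_sub hms']
    congr 1
    ext g
    simp only [Set.mem_compl_iff, Set.mem_ofPred_eq, not_lt, Set.mem_preimage]
    rw [norm_mul, Complex.norm_real, Real.norm_of_nonneg hsN.le, ← hTe, mul_comm T,
      mul_le_mul_iff_right₀ hsN]
  rw [h1]
  refine measureReal_mono fun z hz => ?_
  simp only [Set.mem_preimage, Set.mem_ofPred_eq] at hz ⊢
  have h2 : ‖a‖ * √D = ‖a * D‖ / √D := by
    rw [norm_mul, Complex.norm_real, Real.norm_of_nonneg hD.le, mul_div_assoc, Real.div_sqrt]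
  rw [nuHat_eq hP, h2, ← sub_div, abs_div, abs_of_pos hsD, div_le_iff₀ hsD]
  refine (abs_norm_sub_norm_le _ _).trans ?_
  rw [add_sub_cancel_left]
  exact hz

end Statistic

/-! ### The confidence interval -/

section Confidence

variable {Ω : Type*} [MeasurableSpace Ω] {μ : Measure Ω} [IsProbabilityMeasure μ] {k m : ℕ}

theorem measurable_nuHat_of {α : Type*} [MeasurableSpace α] {s x : α → Fin k → ℂ}
    {P : α → Matrix (Fin k) (Fin k) ℂ} (hs : Measurable s) (hP : Measurable P)
    (hx : Measurable x) : Measurable fun ω => nuHat (s ω) (P ω) (x ω) := by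
  have hPi := measurable_inv_of hP
  have h1 : Measurable fun ω => star (s ω) ⬝ᵥ ((P ω)⁻¹ *ᵥ x ω) :=
    measurable_star_dotProduct_of hs (measurable_mulVec_of hPi hx)
  have h2 : Measurable fun ω => (star (s ω) ⬝ᵥ ((P ω)⁻¹ *ᵥ s ω)).re :=
    Complex.measurable_re.comp (measurable_star_dotProduct_of hs (measurable_mulVec_of hPi hs))
  exact h1.norm.div h2.sqrt

theorem measurable_amfStat_of {α : Type*} [MeasurableSpace α] {s x : α → Fin k → ℂ}
    {P : α → Matrix (Fin k) (Fin k) ℂ} (hs : Measurable s) (hP : Measurable P)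
    (hx : Measurable x) : Measurable fun ω => amfStat (s ω) (P ω) (x ω) := by
  have hPi := measurable_inv_of hP
  have h1 : Measurable fun ω => star (s ω) ⬝ᵥ ((P ω)⁻¹ *ᵥ x ω) :=
    measurable_star_dotProduct_of hs (measurable_mulVec_of hPi hx)
  have h2 : Measurable fun ω => (star (s ω) ⬝ᵥ ((P ω)⁻¹ *ᵥ s ω)).re :=
    Complex.measurable_re.comp (measurable_star_dotProduct_of hs (measurable_mulVec_of hPi hs))
  exact (h1.norm.pow_const 2).div h2

theorem measurable_signalForm_of {α : Type*} [MeasurableSpace α] {s : α → Fin k → ℂ}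
    {P : α → Matrix (Fin k) (Fin k) ℂ} (hs : Measurable s) (hP : Measurable P) :
    Measurable fun ω => signalForm (P ω) (s ω) :=
  Complex.measurable_re.comp
    (measurable_star_dotProduct_of hs (measurable_mulVec_of (measurable_inv_of hP) hs))

/-- A lower bound for the conditional coverage probability on an event `G` of the data on which
the standardized noise is nearly standard. -/
theorem le_condProb_confidence {R : Matrix (Fin k) (Fin k) ℂ} (hR : R.PosDef)
    {s : Ω → Fin k → ℂ} {X : Ω → Matrix (Fin k) (Fin m) ℂ} {x : Ω → Fin k → ℂ}
    (hs : Measurable s) (hX : Measurable X) (hx : Measurable x) {a : ℂ}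
    (hx_law : HasLaw (fun ω => x ω - a • s ω) (complexGaussian 0 R) μ)
    (hx_indep : IndepFun (fun ω => x ω - a • s ω) (fun ω => (s ω, X ω)) μ)
    {Rhat : Matrix (Fin k) (Fin m) ℂ → Matrix (Fin k) (Fin k) ℂ} (hRm : Measurable Rhat)
    (hRpos : ∀ Y, (Rhat Y).PosDef) {q q' τ δ : ℝ} (hτ : 0 ≤ τ)
    (hδr : δ ≤ √(Real.log (1 / (1 - q))))
    {G : Set ((Fin k → ℂ) × Matrix (Fin k) (Fin k) ℂ)} (hG : MeasurableSet G)
    (hGprop : ∀ v P, (v, P) ∈ G → 0 < signalForm P v ∧ 0 < noiseForm R P v ∧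
      δ ≤ ‖a‖ * √(signalForm P v) ∧
      stdComplexGaussian.real {g : ℂ | √τ < ‖((‖a‖ * √(signalForm P v) : ℝ) : ℂ) +
        (√(noiseForm R P v / signalForm P v) : ℝ) * g‖} ∈
        Set.Icc (marcumQ τ ((‖a‖ * √(signalForm P v) - δ) ^ 2))
          (marcumQ τ ((‖a‖ * √(signalForm P v) + δ) ^ 2)) ∧
      q' ≤ 1 - Real.exp (-((√(Real.log (1 / (1 - q))) - δ) /
        √(noiseForm R P v / signalForm P v)) ^ 2)) (hδ : 0 ≤ δ) :
    ∀ᵐ ω ∂μ, (s ω, Rhat (X ω)) ∈ G →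
      q' ≤ (μ⟦{ω | detRate μ s X x Rhat τ ω ∈
          Set.Icc (marcumQ τ (nuMinus q (s ω) (Rhat (X ω)) (x ω) ^ 2))
            (marcumQ τ (nuPlus q (s ω) (Rhat (X ω)) (x ω) ^ 2))} | dataSigma s X⟧) ω := by
  set r := √(Real.log (1 / (1 - q))) with hr
  set W : Ω → (Fin k → ℂ) × Matrix (Fin k) (Fin m) ℂ := fun ω => (s ω, X ω) with hW
  set Z : Ω → Fin k → ℂ := fun ω => x ω - a • s ω with hZ
  have hWm : Measurable W := hs.prodMk hX
  have hZm : Measurable Z := hx.sub (hs.const_smul a)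
  have hxZ : ∀ ω, Z ω + a • s ω = x ω := fun ω => sub_add_cancel _ _
  have hm1 : Measurable fun w : ((Fin k → ℂ) × Matrix (Fin k) (Fin m) ℂ) × (Fin k → ℂ) =>
      w.1.1 := measurable_fst.fst
  have hm2 : Measurable fun w : ((Fin k → ℂ) × Matrix (Fin k) (Fin m) ℂ) × (Fin k → ℂ) =>
      Rhat w.1.2 := hRm.comp measurable_fst.snd
  have hm3 : Measurable fun w : ((Fin k → ℂ) × Matrix (Fin k) (Fin m) ℂ) × (Fin k → ℂ) =>
      w.2 + a • w.1.1 := measurable_snd.add (hm1.const_smul a)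
  -- the detection rate
  have hdet : detRate μ s X x Rhat τ =ᵐ[μ] fun ω => (complexGaussian 0 R).real
      {z | τ < amfStat (s ω) (Rhat (X ω)) (z + a • s ω)} := by
    have h := condProb_of_indepFun hWm hZm hx_law hx_indep
      (E := {w | τ < amfStat w.1.1 (Rhat w.1.2) (w.2 + a • w.1.1)})
      (measurableSet_lt measurable_const (measurable_amfStat_of hm1 hm2 hm3))
    simp only [Set.mem_ofPred_eq, W, hxZ] at h
    exact h
  -- the event on which the estimate is close to the true value
  set E : Set (((Fin k → ℂ) × Matrix (Fin k) (Fin m) ℂ) × (Fin k → ℂ)) :=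
    {w | (w.1.1, Rhat w.1.2) ∈ G ∧ |nuHat w.1.1 (Rhat w.1.2) (w.2 + a • w.1.1) -
      ‖a‖ * √(signalForm (Rhat w.1.2) w.1.1)| ≤ r - δ} with hE
  have hEm : MeasurableSet E := by
    refine (hm1.prodMk hm2 hG).inter (measurableSet_le (Measurable.abs (Measurable.sub
      (measurable_nuHat_of hm1 hm2 hm3) ?_)) measurable_const)
    exact (measurable_signalForm_of hm1 hm2).sqrt.const_mul _
  have hcE := condProb_of_indepFun hWm hZm hx_law hx_indep hEm
  -- the coverage event
  set A : Set Ω := {ω | detRate μ s X x Rhat τ ω ∈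
          Set.Icc (marcumQ τ (nuMinus q (s ω) (Rhat (X ω)) (x ω) ^ 2))
            (marcumQ τ (nuPlus q (s ω) (Rhat (X ω)) (x ω) ^ 2))} with hA
  have hnu : Measurable fun ω => nuHat (s ω) (Rhat (X ω)) (x ω) :=
    measurable_nuHat_of hs (hRm.comp hX) hx
  have hAm : MeasurableSet A := by
    have hQ := (continuous_marcumQ_max_sq hτ).measurable
    have hd : Measurable (detRate μ s X x Rhat τ) :=
      (stronglyMeasurable_condExp.mono hWm.comap_le).measurable
    exact (measurableSet_le (hQ.comp (hnu.sub_const r)) hd).inter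
      (measurableSet_le hd (hQ.comp (hnu.add_const r)))
  -- The inclusion holds only almost surely, because the detection rate is a conditional
  -- expectation; monotonicity of conditional expectation needs no more.
  have hsub : ∀ᵐ ω ∂μ, {ω | (W ω, Z ω) ∈ E}.indicator (fun _ => (1 : ℝ)) ω ≤
      A.indicator (fun _ => (1 : ℝ)) ω := by
    filter_upwards [hdet] with ω hω
    by_cases hmem : (W ω, Z ω) ∈ E
    swap
    · rw [Set.indicator_of_notMem (s := {ω | (W ω, Z ω) ∈ E}) hmem]
      exact Set.indicator_nonneg (fun _ _ => zero_le_one) _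
    obtain ⟨hGω, hclose⟩ := hmem
    simp only [W, hxZ] at hGω hclose
    obtain ⟨hD, -, hδν, ⟨hlo, hhi⟩, -⟩ := hGprop _ _ hGω
    rw [← complexGaussian_lt_amfStat hR.posSemidef (hRpos _) hD hτ a, ← hω] at hlo hhi
    rw [abs_le] at hclose
    -- The detection rate sits between the values of `Q` at `ν - δ` and `ν + δ`, and `|ν̂ - ν| ≤ r -
    -- δ` puts these two points between `ν̂ - r` and `ν̂ + r`. Since `ν - δ ≥ 0`, truncating the
    -- lower limit at zero does no harm.
    have hAω : ω ∈ A := by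
      refine ⟨le_trans ?_ hlo, hhi.trans ?_⟩
      · refine marcumQ_sq_mono hτ (le_max_left _ _) ?_
        exact max_le (sub_nonneg.2 hδν) (by linarith)
      · refine marcumQ_sq_mono hτ (by positivity) ?_
        exact le_trans (by linarith) (le_max_right _ _)
    rw [Set.indicator_of_mem hAω]
    exact Set.indicator_le_self' (fun _ _ => zero_le_one) _
  have hmono := condExp_mono (m := dataSigma s X) ((integrable_const (1 : ℝ)).indicator
    (hWm.prodMk hZm hEm)) ((integrable_const (1 : ℝ)).indicator hAm) hsub
  filter_upwards [hmono, hcE] with ω h1 h2 hωG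
  refine le_trans ?_ h1
  refine le_of_le_of_eq ?_ h2.symm
  obtain ⟨hD, hN, -, -, hq'⟩ := hGprop _ _ hωG
  refine hq'.trans ((le_complexGaussian_abs_nuHat_sub hR.posSemidef (hRpos _) hD hN a
    (sub_nonneg.2 hδr)).trans (measureReal_mono fun z hz => ?_))
  exact ⟨hωG, hz⟩

end Confidence

/-! ### Choice of the margins and proof of the theorem -/

theorem one_le_specNorm {k : ℕ} {R : Matrix (Fin k) (Fin k) ℂ} (hR : R.IsHermitian)
    (h : 1 ∈ spectrum ℝ R) : 1 ≤ specNorm R := by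
  rw [hR.spectrum_real_eq_range_eigenvalues] at h
  obtain ⟨i, hi⟩ := h
  exact (hi.symm.le.trans (le_abs_self _)).trans (abs_eigenvalues_le hR i)

/-- At `δ = 0`, `σ = 1` the right-hand side equals `q`. Continuity allows a positive `δ` first, and
then a neighbourhood of `σ = 1` depending on `δ`. -/
theorem exists_margin {q : ℝ} (hq0 : 0 < q) (hq1 : q < 1) {ε c : ℝ} (hε : 0 < ε) (hc : 0 < c) :
    ∃ δ, 0 < δ ∧ δ ≤ c ∧ δ ≤ √(Real.log (1 / (1 - q))) ∧ ∀ᶠ σ : ℝ in 𝓝 1,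
      q - ε ≤ 1 - Real.exp (-((√(Real.log (1 / (1 - q))) - δ) / σ) ^ 2) := by
  have hlog : 0 < Real.log (1 / (1 - q)) :=
    Real.log_pos ((one_lt_div (by linarith)).2 (by linarith))
  set r := √(Real.log (1 / (1 - q))) with hr
  have hr0 : 0 < r := Real.sqrt_pos.2 hlog
  have hval : 1 - Real.exp (-(r - 0) ^ 2) = q := by
    rw [sub_zero, hr, Real.sq_sqrt hlog.le, ← Real.log_inv, one_div, inv_inv,
      Real.exp_log (by linarith)]
    ring
  have hcont : Continuous fun δ : ℝ => 1 - Real.exp (-(r - δ) ^ 2) := by fun_prop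
  have h1 : ∀ᶠ δ : ℝ in 𝓝[>] 0, q - ε < 1 - Real.exp (-(r - δ) ^ 2) :=
    (hcont.continuousAt.eventually_const_lt (hval.symm ▸ sub_lt_self q hε : q - ε < 1 - Real.exp (-(r - 0) ^ 2))).filter_mono
      nhdsWithin_le_nhds
  obtain ⟨δ, hδ1, hδ2⟩ := (h1.and (Ioo_mem_nhdsGT (lt_min hc hr0))).exists
  refine ⟨δ, hδ2.1, hδ2.2.le.trans (min_le_left _ _), hδ2.2.le.trans (min_le_right _ _), ?_⟩
  have hcσ : ContinuousAt (fun σ : ℝ => 1 - Real.exp (-((r - δ) / σ) ^ 2)) 1 := by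
    fun_prop (disch := norm_num)
  filter_upwards [hcσ.eventually_const_lt
    (show q - ε < 1 - Real.exp (-((r - δ) / 1) ^ 2) by rwa [div_one])] with σ hσ using hσ.le

end AMF

theorem theorem4 {Ω : Type*} [MeasurableSpace Ω] (μ : Measure Ω) [IsProbabilityMeasure μ]
    -- proportional growth of the dimensions
    (p : ℕ → ℕ) (γ : ℝ) (hγ : 0 < γ) (hγ1 : γ ≠ 1)
    (hp : Tendsto (fun n : ℕ => (p n : ℝ) / (n : ℝ)) atTop (𝓝 γ))
    -- the disturbance covariance matrices
    (M : ℝ) (R : ∀ n, Matrix (Fin (p n)) (Fin (p n)) ℂ)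
    (hR : ∀ n, 1 ≤ n → (R n).PosDef)
    (hR_min : ∀ n, 1 ≤ n → IsLeast (spectrum ℝ (R n)) 1)
    (hR_norm : ∀ n, 1 ≤ n → AMF.specNorm (R n) = M)
    -- steering vectors, training data, and test data
    (s : ∀ n, Ω → Fin (p n) → ℂ) (X : ∀ n, Ω → Matrix (Fin (p n)) (Fin n) ℂ)
    (x : ∀ n, Ω → Fin (p n) → ℂ)
    (hs_meas : ∀ n, 1 ≤ n → Measurable (s n))
    (hX_meas : ∀ n, 1 ≤ n → Measurable (X n))
    (hx_meas : ∀ n, 1 ≤ n → Measurable (x n))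
    -- the steering vector is uniform on the unit sphere
    (hs : ∀ n, 1 ≤ n → HasLaw (s n) (AMF.sphereUniform (p n)) μ)
    -- the columns of the training data are i.i.d. `CN(0, R n)`
    (hX_indep : ∀ n, 1 ≤ n → iIndepFun (fun (j : Fin n) (ω : Ω) => (X n ω).col j) μ)
    (hX_law : ∀ n, 1 ≤ n → ∀ j : Fin n,
      HasLaw (fun ω => (X n ω).col j) (AMF.complexGaussian 0 (R n)) μ)
    -- the training data are independent of the steering vector
    (hsX : ∀ n, 1 ≤ n → IndepFun (s n) (X n) μ)
    -- the alternative hypothesis: given the steering vector and the training data, the test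
    -- datum is distributed as `CN(a • s n, R n)`
    (a : ℂ) (ha : a ≠ 0)
    (hx_law : ∀ n, 1 ≤ n →
      HasLaw (fun ω => x n ω - a • s n ω) (AMF.complexGaussian 0 (R n)) μ)
    (hx_indep : ∀ n, 1 ≤ n →
      IndepFun (fun ω => x n ω - a • s n ω) (fun ω => (s n ω, X n ω)) μ)
    -- the estimator
    (Rhat : ∀ n, Matrix (Fin (p n)) (Fin n) ℂ → Matrix (Fin (p n)) (Fin (p n)) ℂ)
    (hRhat : AMF.IsOracleConsistent μ R X Rhat)
    -- the confidence and the threshold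
    (q : ℝ) (hq0 : 0 ≤ q) (hq1 : q < 1) (τ : ℝ) (hτ : 0 ≤ τ) :
    AMF.AsympLE μ (fun _ _ => q)
      (fun n => μ⟦{ω | AMF.detRate μ (s n) (X n) (x n) (Rhat n) τ ω ∈
          Set.Icc (AMF.marcumQ τ (AMF.nuMinus q (s n ω) (Rhat n (X n ω)) (x n ω) ^ 2))
            (AMF.marcumQ τ (AMF.nuPlus q (s n ω) (Rhat n (X n ω)) (x n ω) ^ 2))} |
        AMF.dataSigma (s n) (X n)⟧) := by
  have hpt := AMF.tendsto_atTop_of_ratio hγ hp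
  have hM1 : 1 ≤ M :=
    hR_norm 1 le_rfl ▸ AMF.one_le_specNorm (hR 1 le_rfl).1 (hR_min 1 le_rfl).1
  rw [AMF.AsympLE, tendstoInMeasure_iff_norm]
  intro ε hε
  set π : ∀ n, Ω → ℝ := fun n => μ⟦{ω | AMF.detRate μ (s n) (X n) (x n) (Rhat n) τ ω ∈
          Set.Icc (AMF.marcumQ τ (AMF.nuMinus q (s n ω) (Rhat n (X n ω)) (x n ω) ^ 2))
            (AMF.marcumQ τ (AMF.nuPlus q (s n ω) (Rhat n (X n ω)) (x n ω) ^ 2))} |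
        AMF.dataSigma (s n) (X n)⟧ with hπ
  -- For `q = 0` the radius `r` vanishes and leaves no room for a margin, but the claim only says
  -- that a conditional probability is nonnegative.
  obtain rfl | hq := hq0.eq_or_lt
  · refine tendsto_const_nhds.congr fun n => (measure_eq_zero_iff_ae_notMem.2 ?_).symm
    have hnn : 0 ≤ᵐ[μ] π n :=
      condExp_nonneg (ae_of_all _ fun ω => Set.indicator_nonneg (fun _ _ => zero_le_one) ω)
    filter_upwards [hnn] with ω hω
    have : max (0 - π n ω) 0 = 0 := max_eq_right (by linarith [show 0 ≤ π n ω from hω])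
    change ¬ ε ≤ ‖max (0 - π n ω) 0 - 0‖
    rw [this, sub_zero, norm_zero]
    exact not_le.2 hε
  have ha0 : 0 < ‖a‖ := norm_pos_iff.2 ha
  -- On the good event `1 / (2 M) ≤ D ≤ 2`, so `ν = ‖a‖ √D` stays in the compact interval `[c₀, ‖a‖
  -- √2]`.
  set c₀ := ‖a‖ * √(1 / (2 * M)) with hc₀
  have hc₀pos : 0 < c₀ := by positivity
  obtain ⟨δ, hδ0, hδc, hδr, hδσ⟩ := AMF.exists_margin hq hq1 (half_pos hε) hc₀pos
  have hsqrt : Tendsto (fun y : ℝ => √y) (𝓝 1) (𝓝 1) := by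
    simpa using Real.continuous_sqrt.tendsto 1
  obtain ⟨η, hη, hball⟩ := Metric.eventually_nhds_iff.1 (hsqrt.eventually
    (hδσ.and (AMF.eventually_tail_mem_Icc (c₁ := ‖a‖ * √2) hτ hδ0 hδc)))
  -- The first bound gives `D ≥ 1 / (2 M)` and `N > 0`, the second `D ≤ 2`, and the third `|N / D -
  -- 1| ≤ ε' / D ≤ 2 M ε' < η`.
  obtain ⟨ε', hε', he1, he2, he3⟩ :
      ∃ ε' : ℝ, 0 < ε' ∧ ε' ≤ 1 / (4 * M) ∧ ε' ≤ 1 ∧ 2 * M * ε' < η := by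
    refine ⟨min (1 / (4 * M)) (η / (4 * M)), by positivity, min_le_left _ _, ?_, ?_⟩
    · refine (min_le_left _ _).trans ?_
      rw [div_le_one (by positivity)]
      linarith
    · calc 2 * M * min (1 / (4 * M)) (η / (4 * M)) ≤ 2 * M * (η / (4 * M)) := by
            gcongr
            exact min_le_right _ _
        _ = η / 2 := by field_simp; ring
        _ < η := half_lt_self hη
  have hlim := AMF.tendsto_measure_compl_goodSet hpt hR hR_min hR_norm hs_meas hX_meas hs hsX hRhat hε'
  refine tendsto_of_tendsto_of_tendsto_of_le_of_le' tendsto_const_nhds hlim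
    (Eventually.of_forall fun n => zero_le) ?_
  filter_upwards [eventually_ge_atTop 1] with n hn
  have hmain := AMF.le_condProb_confidence (hR n hn) (hs_meas n hn) (hX_meas n hn) (hx_meas n hn)
    (hx_law n hn) (hx_indep n hn) (hRhat.1.measurable n hn) (hRhat.1.posDef n hn) (q := q)
    (q' := q - ε / 2) hτ hδr (AMF.measurableSet_goodSet M ε' (R n)) ?_ hδ0.le
  -- On the good event the conditional coverage is at least `q - ε / 2`, so a deficit of `ε` can
  -- occur only off it.
  · refine measure_mono_ae ?_
    filter_upwards [hmain] with ω hω hbig hgood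
    have h1 : q - ε / 2 ≤ π n ω := hω hgood
    have h2 : ε ≤ ‖max (q - π n ω) 0 - 0‖ := hbig
    rw [sub_zero, Real.norm_of_nonneg (le_max_right _ _), le_max_iff] at h2
    obtain h2 | h2 := h2 <;> linarith
  · rintro v P ⟨hg1, hg2, hg3⟩
    change 1 / M - ε' ≤ AMF.signalForm P v at hg1
    change AMF.signalForm P v ≤ 1 + ε' at hg2
    change |AMF.noiseForm (R n) P v - AMF.signalForm P v| ≤ ε' at hg3
    have hM4 : 1 / M = 4 * (1 / (4 * M)) := by field_simp
    have hM2 : 1 / (2 * M) = 2 * (1 / (4 * M)) := by field_simp; norm_num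
    have hM4pos : 0 < 1 / (4 * M) := by positivity
    set D := AMF.signalForm P v
    set N := AMF.noiseForm (R n) P v
    have hDlo : 1 / (2 * M) ≤ D := by linarith
    have hD0 : 0 < D := by linarith
    have hD2 : D ≤ 2 := by linarith
    rw [abs_le] at hg3
    have hN0 : 0 < N := by linarith
    have hratio : dist (N / D) 1 < η := by
      rw [Real.dist_eq, div_sub_one hD0.ne', abs_div, abs_of_pos hD0, div_lt_iff₀ hD0]
      have h1 : |N - D| ≤ ε' := abs_le.2 hg3
      have h2 : 2 * M * ε' * D < η * D := by gcongr
      have h3 : 1 ≤ 2 * M * D := by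
        rw [div_le_iff₀ (by positivity)] at hDlo
        linarith
      nlinarith
    obtain ⟨hb1, hb2⟩ := hball hratio
    have hν : ‖a‖ * √D ∈ Set.Icc c₀ (‖a‖ * √2) :=
      ⟨mul_le_mul_of_nonneg_left (Real.sqrt_le_sqrt hDlo) ha0.le,
        mul_le_mul_of_nonneg_left (Real.sqrt_le_sqrt hD2) ha0.le⟩
    exact ⟨hD0, hN0, hδc.trans hν.1, hb2 _ hν, hb1⟩
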